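/- Let $\mathsf d\ge 1$ and let $\mathsf g(x)=-\log|x|$ if $\mathsf d\in\{1,2\}$ (the logarithmic cases), $\mathsf g(x)=|x|^{2-\mathsf d}$ if $\mathsf d\ge 3$ (the Coulomb case), with $\mathsf g(0)=+\infty$. For $V:\mathbb R^{\mathsf d}\to\mathbb R$ and $x_1,\dots,x_N\in\mathbb R^{\mathsf d}$ put $$\mathcal H_N(x_1,\dots,x_N)=\sum_{1\le i\ne j\le N}\mathsf g(x_i-x_j)+N\sum_{i=1}^N V(x_i),\qquad Z_{N,\beta}=\int_{(\mathbb R^{\mathsf d})^N}\exp\Big(-\frac\beta2 N^{\min(\frac2{\mathsf d}-1,0)}\mathcal H_N\Big)\,dx_1\cdots dx_N ,$$ and for a probability measure $\mu$ on $\mathbb R^{\mathsf d}$ $$\mathcal I_V(\mu)=\iint \mathsf g(x-y)\,d\mu(x)\,d\mu(y)+\int V\,d\mu ,$$ which is called finite if both integrals converge absolutely. A probability measure $\mu_V$ is the equilibrium measure of $V$ if $\mathcal I_V(\mu_V)$ is finite and $\mathcal I_V(\mu_V)\le\mathcal I_V(\nu)$ for every probability measure $\nu$ with $\mathcal I_V(\nu)$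 finite. Let $\beta>0$. Assume that $V$ is continuous, that it has an equilibrium measure $\mu_V$, that $\mu_V$ has an $L^\infty$ density with respect to Lebesgue measure, and that $V$ satisfies **(A3)** for all $N$ large enough, $\int_{\mathbb R^{\mathsf d}} e^{-\beta N(\frac{V(x)}2-\log|x|)}\,dx<\infty$ if $\mathsf d\in\{1,2\}$, respectively $\int_{\mathbb R^{\mathsf d}} e^{-\frac\beta2 N V(x)}\,dx<\infty$ if $\mathsf d\ge3$. Then for all $N$ large enough (depending on $V$ and $\beta$) the integral defining $Z_{N,\beta}$ converges, and $$\log Z_{N,\beta}=-\frac\beta2 N^{\min(2,\frac2{\mathsf d}+1)}\,\mathcal I_V(\mu_V)+\Big(\frac{\beta}{2\mathsf d}N\log N\Big)\mathbf 1_{\mathsf d\in\{1,2\}}+O(N),$$ where the $O(N)$ is bounded in absolute value by $CN$ with a constant $C$ that depends only on $\beta$, $\mu_V$ and $\mathsf d$ (and not otherwise on $V$). -/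

import Mathlib

open MeasureTheory Filter

noncomputable section

namespace CoulombGas

/-- The pair interaction on `ℝ^d`: `g(x) = -log |x|` for `d = 1, 2` (the logarithmic cases) and
`g(x) = |x|^(2-d)` for `d ≥ 3` (the Coulomb case). The value at `x = 0`, mathematically `+∞`, is a
junk value; it is excluded from every use below that it could affect. -/
def g (d : ℕ) (x : EuclideanSpace ℝ (Fin d)) : ℝ :=
  if d ≤ 2 then -Real.log ‖x‖ else ‖x‖ ^ (2 - (d : ℝ))

/-- The Hamiltonian `∑_{i ≠ j} g(x_i - x_j) + ∑_i N V(x_i)` (sum over ordered pairs). -/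
def hamiltonian {d : ℕ} (V : EuclideanSpace ℝ (Fin d) → ℝ) {N : ℕ}
    (X : Fin N → EuclideanSpace ℝ (Fin d)) : ℝ :=
  ∑ p ∈ (Finset.univ : Finset (Fin N)).offDiag, g d (X p.1 - X p.2) + ∑ i, (N : ℝ) * V (X i)

/-- The unnormalized Gibbs density `exp(-(β/2) N^{min(2/d-1,0)} H_N)`. In the logarithmic cases
the power of `N` is `1`. -/
def gibbsWeight {d : ℕ} (V : EuclideanSpace ℝ (Fin d) → ℝ) (β : ℝ) {N : ℕ}
    (X : Fin N → EuclideanSpace ℝ (Fin d)) : ℝ :=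
  Real.exp (-(β / 2) * (N : ℝ) ^ min (2 / (d : ℝ) - 1) 0 * hamiltonian V X)

/-- The partition function `Z_{N,β}`, an integral over `(ℝ^d)^N`. -/
def partitionFunction {d : ℕ} (V : EuclideanSpace ℝ (Fin d) → ℝ) (β : ℝ) (N : ℕ) : ℝ :=
  ∫ X : Fin N → EuclideanSpace ℝ (Fin d), gibbsWeight V β X

/-- `I_V(μ)` is finite: both integrals in its definition converge absolutely. As `g(0) = +∞`,
a measure that charges a point has infinite energy, which is what `noAtoms` records (it says that
the diagonal is null for `μ ⊗ μ`). -/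
structure HasFiniteEnergy {d : ℕ} (V : EuclideanSpace ℝ (Fin d) → ℝ)
    (μ : Measure (EuclideanSpace ℝ (Fin d))) : Prop where
  noAtoms : ∀ x, μ {x} = 0
  integrable_interaction : Integrable
    (fun p : EuclideanSpace ℝ (Fin d) × EuclideanSpace ℝ (Fin d) => g d (p.1 - p.2)) (μ.prod μ)
  integrable_potential : Integrable V μ

/-- The value of `I_V(μ) = ∬ g(x-y) dμ(x) dμ(y) + ∫ V dμ` on measures of finite energy. -/
def energy {d : ℕ} (V : EuclideanSpace ℝ (Fin d) → ℝ)
    (μ : Measure (EuclideanSpace ℝ (Fin d))) : ℝ :=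
  ∫ p : EuclideanSpace ℝ (Fin d) × EuclideanSpace ℝ (Fin d), g d (p.1 - p.2) ∂(μ.prod μ)
    + ∫ x, V x ∂μ

/-- `μ` is an equilibrium measure of `V`: it minimizes `I_V` over the probability measures on
`ℝ^d`, with a finite minimum. -/
structure IsEquilibriumMeasure {d : ℕ} (V : EuclideanSpace ℝ (Fin d) → ℝ)
    (μ : Measure (EuclideanSpace ℝ (Fin d))) : Prop where
  isProbabilityMeasure : IsProbabilityMeasure μ
  hasFiniteEnergy : HasFiniteEnergy V μ
  energy_le : ∀ ν : Measure (EuclideanSpace ℝ (Fin d)), IsProbabilityMeasure ν →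
    HasFiniteEnergy V ν → energy V μ ≤ energy V ν

/-- `μ` has a bounded density with respect to Lebesgue measure. -/
def HasBoundedDensity {d : ℕ} (μ : Measure (EuclideanSpace ℝ (Fin d))) : Prop :=
  ∃ ρ : EuclideanSpace ℝ (Fin d) → ℝ, MemLp ρ ⊤ volume ∧
    μ = volume.withDensity (fun x => ENNReal.ofReal (ρ x))

/-- The growth assumption (A3) at inverse temperature `β`: for `N` large enough,
`∫ exp(-β N (V(x)/2 - log |x|)) dx < ∞` if `d ≤ 2`, and `∫ exp(-(β/2) N V(x)) dx < ∞` if `d ≥ 3`. -/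
def AssumptionA3 {d : ℕ} (V : EuclideanSpace ℝ (Fin d) → ℝ) (β : ℝ) : Prop :=
  ∀ᶠ N : ℕ in atTop, Integrable (fun x : EuclideanSpace ℝ (Fin d) =>
    if d ≤ 2 then Real.exp (-β * N * (V x / 2 - Real.log ‖x‖))
    else Real.exp (-(β / 2) * N * V x)) volume

end CoulombGas

end

/-!
The interaction is a mixture of Gaussian scales: for `x ≠ 0`,
`g(x) = selfEnergy T - lowPart T x + highPart T x`, where `selfEnergy T - lowPart T` collects the
Gaussians `exp(-t |x|²)` with `t ≤ T` and the positive `highPart T` those with `t > T` (`g_eq`).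
Everything is read at the scale `T = N^{2/d}`, for which `exp(-T |x|²)` lives at the typical distance
`N^{-1/d}` between neighbouring points.

*Upper bound on `Z`.* Dropping `highPart` bounds the energy of distinct points from below by a
smooth, conditionally positive definite interaction; adding its diagonal back costs
`N * selfEnergy T`, which is `(N log N)/d + O(N)` in the logarithmic cases. Positivity of the energy
of `∑ δ_{x_i} - N μ` compares the result with its mean-field value, and the error made on the
potential of `μ` is `‖ρ‖_∞ ∫ highPart T`, of the right order because `μ` has a bounded density. This
gives `IsTame.hamiltonian_ge`:
`H_N ≥ N² I_V(μ) + N ∑ ζ(x_i) - (N log N)/d - …` with the effective potential `ζ = 2 g * μ + V - c`.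
The Euler–Lagrange conditions say that `ζ ≥ 0` almost everywhere, with equality `μ`-almost
everywhere.

The zero set `Z_V` of `ζ` can be much larger than the set `S` that carries `μ`, so that integrating
`exp(-θ ζ)` alone would leave a constant `log |Z_V|` that depends on `V`. A part of the positive
energy which was discarded removes it: the energy of `σ = ∑ δ_{x_i} - N μ` dominates
`2 a ⟨σ, η⟩ - a² ‖η‖²` for every `η`, hence every linear statistic `∑ h(x_i) - N ∫ h dμ` with
`h ∈ C_c` (`IsTame.exists_truncatedEnergy_ge`), at a cost `o(N)` that may depend on `V`. With `h` large
on most of `Z_V \ S` and `∫ h dμ ≤ 1`, the one-particle integrals are at most `|S| + 3`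
(`exists_penalty_integral_exp_le`).

*Lower bound on `Z`.* Jensen's inequality is applied to independent points. If `d ≥ 3` all of them
have law `μ`. If `d ≤ 2` the mass of `μ` is cut into `N` cells of mass `1/N`, with one point in each:
the `N!` assignments of points to cells compensate the entropy, and the mean energy is
`N² I_V(μ)` minus the self-interactions of the cells, which are at least `(log N)/d - O(1)` on average
because the cells have diameter of order `N^{-1/d}` on average. The cells are cut at quantiles
of the coordinates. As the support of `μ` may be unbounded, diameters are measured after the
compactification `u ↦ u / (1 + |u|)` of each coordinate, at the price of a logarithmic moment of `μ`.
-/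

noncomputable section

namespace CoulombGas

open scoped ENNReal NNReal Topology

variable {d : ℕ} {M M' K : ℝ≥0} {μ ν : Measure (EuclideanSpace ℝ (Fin d))}
  {V : EuclideanSpace ℝ (Fin d) → ℝ} {β : ℝ}

/-! ### Positive definiteness of the Gaussian kernel -/

/-- The ambient space `ℝ^d` with its Euclidean norm. -/
abbrev Space (d : ℕ) : Type := EuclideanSpace ℝ (Fin d)

/-- The Gaussian kernel `exp(-t |x|²)`. -/
def gauss {d : ℕ} (t : ℝ) (x : Space d) : ℝ := Real.exp (-t * ‖x‖ ^ 2)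

lemma gauss_pos (t : ℝ) (x : Space d) : 0 < gauss t x := Real.exp_pos _

lemma gauss_le_one {t : ℝ} (ht : 0 ≤ t) (x : Space d) : gauss t x ≤ 1 := by
  rw [gauss, Real.exp_le_one_iff]
  nlinarith [mul_nonneg ht (sq_nonneg ‖x‖)]

lemma gauss_zero (t : ℝ) : gauss t (0 : Space d) = 1 := by simp [gauss]

lemma gauss_sub_comm (t : ℝ) (x y : Space d) : gauss t (x - y) = gauss t (y - x) := by
  rw [gauss, gauss, norm_sub_rev]

lemma continuous_gauss_uncurry : Continuous fun p : ℝ × Space d => gauss p.1 p.2 := by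
  unfold gauss; fun_prop

lemma continuous_gauss (t : ℝ) : Continuous (gauss t : Space d → ℝ) := by
  unfold gauss; fun_prop

lemma integrable_gauss {t : ℝ} (ht : 0 < t) : Integrable (gauss t : Space d → ℝ) := by
  have := GaussianFourier.integrable_cexp_neg_mul_sq_norm_add (V := Space d) (b := (t : ℂ))
    (by simpa using ht) 0 0
  have h2 := this.re
  refine h2.congr (Eventually.of_forall fun x => ?_)
  simp only [gauss, zero_mul, add_zero]
  have : (Complex.exp (-(t : ℂ) * (‖x‖ : ℂ) ^ 2)) = ((Real.exp (-t * ‖x‖ ^ 2) : ℝ) : ℂ) := by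
    push_cast; rfl
  rw [this]; exact Complex.ofReal_re _

lemma integral_gauss {t : ℝ} (ht : 0 < t) :
    ∫ x : Space d, gauss t x = (Real.pi / t) ^ ((d : ℝ) / 2) := by
  have := GaussianFourier.integral_rexp_neg_mul_sq_norm (V := Space d) ht
  simpa [gauss] using this

lemma gauss_mul_gauss (t : ℝ) (x y z : Space d) :
    gauss (2 * t) (x - z) * gauss (2 * t) (y - z) =
      gauss t (x - y) * gauss (4 * t) (z - (2⁻¹ : ℝ) • (x + y)) := by
  have h1 := parallelogram_law_with_norm ℝ (x - z) (y - z)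
  have e1 : x - z + (y - z) = (-2 : ℝ) • (z - (2⁻¹ : ℝ) • (x + y)) := by module
  have e2 : x - z - (y - z) = x - y := by abel
  rw [e1, e2, norm_smul] at h1
  rw [Real.norm_eq_abs, abs_neg, abs_two] at h1
  simp only [gauss, ← Real.exp_add]
  congr 1
  linear_combination t * h1

lemma integrable_gauss_mul_gauss {t : ℝ} (ht : 0 < t) (x y : Space d) :
    Integrable fun z => gauss (2 * t) (x - z) * gauss (2 * t) (y - z) := by
  simp only [gauss_mul_gauss]
  exact ((integrable_gauss (by positivity)).comp_sub_right _).const_mul _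

/-- The Gaussian is the autocorrelation of a narrower Gaussian; this makes it positive definite. -/
lemma integral_gauss_mul_gauss {t : ℝ} (ht : 0 < t) (x y : Space d) :
    ∫ z, gauss (2 * t) (x - z) * gauss (2 * t) (y - z) =
      gauss t (x - y) * (Real.pi / (4 * t)) ^ ((d : ℝ) / 2) := by
  simp only [gauss_mul_gauss]
  rw [integral_const_mul, integral_sub_right_eq_self (fun z => gauss (4 * t) z),
    integral_gauss (by positivity)]

/-- The Gaussian interaction of two measures. -/
def gaussPairing (t : ℝ) (ν ν' : Measure (Space d)) : ℝ :=
  ∫ x, ∫ y, gauss t (x - y) ∂ν' ∂ν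

lemma integrable_gauss_prod {t : ℝ} (ht : 0 ≤ t) (ν : Measure (Space d × Space d))
    [IsFiniteMeasure ν] : Integrable (fun p => gauss t (p.1 - p.2)) ν := by
  refine Integrable.of_bound (C := 1) ?_ (Eventually.of_forall fun p => ?_)
  · exact ((continuous_gauss t).comp (by fun_prop)).aestronglyMeasurable
  · rw [Real.norm_of_nonneg (gauss_pos _ _).le]; exact gauss_le_one ht _

lemma integrable_gauss_sub {t : ℝ} (ht : 0 ≤ t) (ν : Measure (Space d))
    [IsFiniteMeasure ν] (x : Space d) : Integrable (fun y => gauss t (x - y)) ν := by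
  refine Integrable.of_bound (C := 1) ?_ (Eventually.of_forall fun p => ?_)
  · exact ((continuous_gauss t).comp (by fun_prop)).aestronglyMeasurable
  · rw [Real.norm_of_nonneg (gauss_pos _ _).le]; exact gauss_le_one ht _

lemma gaussPairing_eq_prod {t : ℝ} (ht : 0 ≤ t) (ν ν' : Measure (Space d))
    [IsFiniteMeasure ν] [IsFiniteMeasure ν'] :
    gaussPairing t ν ν' = ∫ p, gauss t (p.1 - p.2) ∂(ν.prod ν') := by
  rw [gaussPairing, integral_prod _ (integrable_gauss_prod ht _)]

lemma gaussPairing_comm {t : ℝ} (ht : 0 ≤ t) (ν ν' : Measure (Space d))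
    [IsFiniteMeasure ν] [IsFiniteMeasure ν'] :
    gaussPairing t ν ν' = gaussPairing t ν' ν := by
  rw [gaussPairing, gaussPairing, integral_integral_swap (integrable_gauss_prod ht _)]
  simp_rw [gauss_sub_comm t]

lemma integrable_gauss_triple {t : ℝ} (ht : 0 < t) (ν ν' : Measure (Space d))
    [IsFiniteMeasure ν] [IsFiniteMeasure ν'] :
    Integrable (fun q : (Space d × Space d) × Space d =>
      gauss (2 * t) (q.1.1 - q.2) * gauss (2 * t) (q.1.2 - q.2)) ((ν.prod ν').prod volume) := by
  have hc : Continuous (fun q : (Space d × Space d) × Space d =>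
      gauss (2 * t) (q.1.1 - q.2) * gauss (2 * t) (q.1.2 - q.2)) :=
    ((continuous_gauss _).comp (by fun_prop)).mul ((continuous_gauss _).comp (by fun_prop))
  rw [integrable_prod_iff hc.aestronglyMeasurable]
  refine ⟨Eventually.of_forall fun p => integrable_gauss_mul_gauss ht p.1 p.2, ?_⟩
  refine ((integrable_gauss_prod ht.le (ν.prod ν')).mul_const
    ((Real.pi / (4 * t)) ^ ((d : ℝ) / 2))).congr (Eventually.of_forall fun p => ?_)
  simp only
  rw [← integral_gauss_mul_gauss ht]
  refine integral_congr_ae (Eventually.of_forall fun z => ?_)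
  exact (Real.norm_of_nonneg (mul_pos (gauss_pos _ _) (gauss_pos _ _)).le).symm

lemma gaussPairing_eq_integral {t : ℝ} (ht : 0 < t) (ν ν' : Measure (Space d))
    [IsFiniteMeasure ν] [IsFiniteMeasure ν'] :
    gaussPairing t ν ν' * (Real.pi / (4 * t)) ^ ((d : ℝ) / 2) =
      ∫ z, (∫ x, gauss (2 * t) (x - z) ∂ν) * (∫ y, gauss (2 * t) (y - z) ∂ν') := by
  rw [gaussPairing_eq_prod ht.le, ← integral_mul_const]
  simp_rw [← integral_gauss_mul_gauss ht]
  rw [integral_integral_swap (f := fun (p : Space d × Space d) z =>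
    gauss (2 * t) (p.1 - z) * gauss (2 * t) (p.2 - z)) (integrable_gauss_triple ht ν ν')]
  refine integral_congr_ae (Eventually.of_forall fun z => ?_)
  exact integral_prod_mul (fun x => gauss (2 * t) (x - z)) (fun y => gauss (2 * t) (y - z))

lemma integrable_gaussTransform_mul {t : ℝ} (ht : 0 < t) (ν ν' : Measure (Space d))
    [IsFiniteMeasure ν] [IsFiniteMeasure ν'] :
    Integrable fun z => (∫ x, gauss (2 * t) (x - z) ∂ν) * (∫ y, gauss (2 * t) (y - z) ∂ν') := by
  refine (integrable_gauss_triple ht ν ν').integral_prod_right.congr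
    (Eventually.of_forall fun z => ?_)
  exact integral_prod_mul (fun x => gauss (2 * t) (x - z)) (fun y => gauss (2 * t) (y - z))

/-- Positive definiteness of the Gaussian kernel, on real combinations of finite measures. -/
lemma gaussPairing_posDef {ι : Type*} [Fintype ι] {t : ℝ} (ht : 0 < t)
    (ν : ι → Measure (Space d)) [∀ i, IsFiniteMeasure (ν i)] (s : ι → ℝ) :
    0 ≤ ∑ k, ∑ l, s k * s l * gaussPairing t (ν k) (ν l) := by
  have hc : (0 : ℝ) < (Real.pi / (4 * t)) ^ ((d : ℝ) / 2) := by positivity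
  refine nonneg_of_mul_nonneg_left ?_ hc
  have key : (∑ k, ∑ l, s k * s l * gaussPairing t (ν k) (ν l)) *
      (Real.pi / (4 * t)) ^ ((d : ℝ) / 2) =
      ∫ z, (∑ k, s k * ∫ x, gauss (2 * t) (x - z) ∂ν k) ^ 2 := by
    simp_rw [sq, Finset.sum_mul_sum]
    rw [integral_finsetSum, Finset.sum_mul]
    · refine Finset.sum_congr rfl fun k _ => ?_
      rw [integral_finsetSum, Finset.sum_mul]
      · refine Finset.sum_congr rfl fun l _ => ?_
        rw [mul_assoc, gaussPairing_eq_integral ht, ← integral_const_mul]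
        refine integral_congr_ae (Eventually.of_forall fun z => ?_)
        simp only; ring
      · intro l _
        refine ((integrable_gaussTransform_mul ht (ν k) (ν l)).const_mul (s k * s l)).congr
          (Eventually.of_forall fun z => ?_)
        simp only; ring
    · intro k _
      refine integrable_finsetSum _ fun l _ => ?_
      refine ((integrable_gaussTransform_mul ht (ν k) (ν l)).const_mul (s k * s l)).congr
        (Eventually.of_forall fun z => ?_)
      simp only; ring
  rw [key]
  exact integral_nonneg fun z => sq_nonneg _

lemma gaussPairing_dirac_left (t : ℝ) (x : Space d) (ν : Measure (Space d)) :
    gaussPairing t (Measure.dirac x) ν = ∫ y, gauss t (x - y) ∂ν := by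
  rw [gaussPairing, integral_dirac]

/-- The Gaussian energy `∬ exp(-t |x-y|²) dσ(x) dσ(y)` of the neutral measure
`σ = ∑ i, δ_{x_i} - N μ`. -/
def gaussEnergy (t : ℝ) (μ : Measure (Space d)) {N : ℕ} (X : Fin N → Space d) : ℝ :=
  ∑ i, ∑ j, gauss t (X i - X j) - 2 * N * ∑ i, ∫ y, gauss t (X i - y) ∂μ
    + (N : ℝ) ^ 2 * gaussPairing t μ μ

/-- Testing the Gaussian energy of `σ` against a finite measure `η`:
`‖σ‖² ≥ 2 a ⟨σ, η⟩ - a² ‖η‖²`. -/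
lemma gaussEnergy_ge {t : ℝ} (ht : 0 < t) (μ : Measure (Space d)) [IsFiniteMeasure μ]
    (η : Measure (Space d)) [IsFiniteMeasure η] (a : ℝ) {N : ℕ} (X : Fin N → Space d) :
    2 * a * (∑ i, ∫ y, gauss t (X i - y) ∂η - N * gaussPairing t μ η)
      - a ^ 2 * gaussPairing t η η ≤ gaussEnergy t μ X := by
  let ν : Fin N ⊕ Bool → Measure (Space d) := Sum.elim (fun i => Measure.dirac (X i))
    (fun b => if b then μ else η)
  let s : Fin N ⊕ Bool → ℝ := Sum.elim (fun _ => 1) (fun b => if b then -(N : ℝ) else -a)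
  have : ∀ i, IsFiniteMeasure (ν i) := by
    rintro (i | b)
    · simp only [ν, Sum.elim_inl]; infer_instance
    · cases b
      · exact (inferInstance : IsFiniteMeasure η)
      · exact (inferInstance : IsFiniteMeasure μ)
  have h := gaussPairing_posDef ht ν s
  have c1 : ∀ i, gaussPairing t μ (Measure.dirac (X i)) = ∫ y, gauss t (X i - y) ∂μ := fun i => by
    rw [gaussPairing_comm ht.le, gaussPairing_dirac_left]
  have c2 : ∀ i, gaussPairing t η (Measure.dirac (X i)) = ∫ y, gauss t (X i - y) ∂η := fun i => by
    rw [gaussPairing_comm ht.le, gaussPairing_dirac_left]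
  have c3 := gaussPairing_comm ht.le η μ
  simp only [Fintype.sum_sum_type, ν, s, Sum.elim_inl, Sum.elim_inr, Fintype.sum_bool,
    if_true, Bool.false_eq_true, if_false, gaussPairing_dirac_left, c1, c2, integral_dirac,
    one_mul, mul_one, Finset.sum_add_distrib, ← Finset.mul_sum, c3] at h
  rw [gaussEnergy]
  linarith

lemma gaussEnergy_nonneg {t : ℝ} (ht : 0 < t) (μ : Measure (Space d)) [IsFiniteMeasure μ]
    {N : ℕ} (X : Fin N → Space d) : 0 ≤ gaussEnergy t μ X := by
  simpa using gaussEnergy_ge ht μ μ 0 X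

/-! ### The interaction as a mixture of Gaussian scales -/

/-- The density of Gaussian scales in `g(x) = ∫ scaleWeight d t * exp(-t |x|²) dt`; in the
logarithmic cases this holds up to the subtraction of an infinite constant. -/
def scaleWeight (d : ℕ) (t : ℝ) : ℝ :=
  if d ≤ 2 then (2 * t)⁻¹ else t ^ ((d : ℝ) / 2 - 2) / Real.Gamma ((d : ℝ) / 2 - 1)

lemma gamma_pos_of_three_le (hd : ¬ d ≤ 2) : 0 < (d : ℝ) / 2 - 1 := by
  have : (3 : ℝ) ≤ d := by exact_mod_cast Nat.succ_le_of_lt (not_le.mp hd)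
  linarith

lemma scaleWeight_pos (d : ℕ) {t : ℝ} (ht : 0 < t) : 0 < scaleWeight d t := by
  unfold scaleWeight
  split_ifs with h
  · positivity
  · have := Real.Gamma_pos_of_pos (gamma_pos_of_three_le h)
    positivity

lemma measurable_scaleWeight (d : ℕ) : Measurable (scaleWeight d) := by
  unfold scaleWeight
  split_ifs <;> fun_prop

/-- The part of the interaction carried by the scales `t ≤ T`, normalized to vanish at `0` and
with the opposite sign. -/
def lowPart (T : ℝ) (x : Space d) : ℝ :=
  ∫ t in Set.Ioc 0 T, scaleWeight d t * (1 - gauss t x)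

/-- The part of the interaction carried by the scales `t > T`. Its value at `0`, mathematically
`+∞`, is a junk value. -/
def highPart (T : ℝ) (x : Space d) : ℝ :=
  ∫ t in Set.Ioi T, scaleWeight d t * gauss t x

/-- The value at the origin of the interaction truncated to the scales `t ≤ T`. -/
def selfEnergy (d : ℕ) (T : ℝ) : ℝ :=
  if d ≤ 2 then Real.log T / 2 + ((∫ u in (0 : ℝ)..1, (1 - Real.exp (-u)) / (2 * u)) -
    ∫ u in Set.Ioi (1 : ℝ), Real.exp (-u) / (2 * u))
  else T ^ ((d : ℝ) / 2 - 1) / (((d : ℝ) / 2 - 1) * Real.Gamma ((d : ℝ) / 2 - 1))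

lemma lowPart_nonneg (T : ℝ) (x : Space d) : 0 ≤ lowPart T x :=
  setIntegral_nonneg measurableSet_Ioc fun t ht =>
    mul_nonneg (scaleWeight_pos d ht.1).le (by linarith [gauss_le_one ht.1.le x])

lemma highPart_nonneg {T : ℝ} (hT : 0 ≤ T) (x : Space d) : 0 ≤ highPart T x :=
  setIntegral_nonneg measurableSet_Ioi fun _ ht =>
    mul_nonneg (scaleWeight_pos d (hT.trans_lt ht)).le (gauss_pos _ _).le

lemma lowPart_zero (T : ℝ) : lowPart T (0 : Space d) = 0 := by
  simp [lowPart, gauss_zero]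

lemma one_sub_exp_div_bound (u : ℝ) (hu : 0 ≤ u) :
    ‖(1 - Real.exp (-u)) / (2 * u)‖ ≤ 1 := by
  rcases hu.eq_or_lt with rfl | hu
  · simp
  have h1 : 1 - Real.exp (-u) ≤ u := by linarith [Real.add_one_le_exp (-u)]
  have h2 : 0 ≤ 1 - Real.exp (-u) := by
    linarith [Real.exp_le_one_iff.mpr (by linarith : -u ≤ 0)]
  rw [Real.norm_of_nonneg (by positivity), div_le_one (by positivity)]
  linarith

lemma intervalIntegrable_one_sub_exp_div {a b : ℝ} (ha : 0 ≤ a) (hb : 0 ≤ b) :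
    IntervalIntegrable (fun u => (1 - Real.exp (-u)) / (2 * u)) volume a b := by
  refine (intervalIntegrable_const (c := (1 : ℝ))).mono_fun' ?_ ?_
  · exact Measurable.aestronglyMeasurable (by fun_prop)
  · refine (ae_restrict_mem measurableSet_uIoc).mono fun u hu => one_sub_exp_div_bound u ?_
    rcases le_total a b with h | h
    · rw [Set.uIoc_of_le h] at hu; exact ha.trans hu.1.le
    · rw [Set.uIoc_of_ge h] at hu; exact hb.trans hu.1.le

lemma integrableOn_exp_div {a : ℝ} (ha : 0 < a) :
    IntegrableOn (fun u => Real.exp (-u) / (2 * u)) (Set.Ioi a) := by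
  refine ((integrableOn_exp_neg_Ioi a).div_const (2 * a)).mono'
    (Measurable.aestronglyMeasurable (by fun_prop)) ?_
  refine (ae_restrict_mem measurableSet_Ioi).mono fun u hu => ?_
  have hu' : a < u := hu
  have hu0 : 0 < u := ha.trans hu'
  rw [Real.norm_of_nonneg (by positivity)]
  gcongr

lemma integrableOn_low (T : ℝ) (x : Space d) :
    IntegrableOn (fun t => scaleWeight d t * (1 - gauss t x)) (Set.Ioc 0 T) := by
  by_cases h : d ≤ 2
  · refine Integrable.mono' (g := fun _ => ‖x‖ ^ 2) (by simp) ?_ ?_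
    · exact ((measurable_scaleWeight d).mul (by unfold gauss; fun_prop)).aestronglyMeasurable
    · refine (ae_restrict_mem measurableSet_Ioc).mono fun t ht => ?_
      have h1 : 1 - gauss t x ≤ t * ‖x‖ ^ 2 := by
        unfold gauss; linarith [Real.add_one_le_exp (-t * ‖x‖ ^ 2)]
      have h2 : 0 ≤ 1 - gauss t x := by linarith [gauss_le_one ht.1.le x]
      have h3 := ht.1
      rw [Real.norm_of_nonneg (mul_nonneg (scaleWeight_pos d ht.1).le h2), scaleWeight, if_pos h]
      rw [inv_mul_le_iff₀ (by positivity)]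
      nlinarith [mul_nonneg h3.le (sq_nonneg ‖x‖)]
  · have hp := gamma_pos_of_three_le h
    have hi : IntegrableOn (scaleWeight d) (Set.Ioc 0 T) := by
      have : scaleWeight d = fun t => t ^ ((d : ℝ) / 2 - 2) / Real.Gamma ((d : ℝ) / 2 - 1) := by
        funext t; rw [scaleWeight, if_neg h]
      rw [this]
      refine Integrable.div_const ?_ _
      exact (intervalIntegral.intervalIntegrable_rpow' (a := 0) (b := T) (by linarith)).1
    have hm : Measurable fun t => scaleWeight d t * (1 - gauss t x) :=
      (measurable_scaleWeight d).mul (by unfold gauss; fun_prop)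
    refine Integrable.mono hi hm.aestronglyMeasurable ?_
    refine (ae_restrict_mem measurableSet_Ioc).mono fun t ht => ?_
    rw [norm_mul]
    refine mul_le_of_le_one_right (norm_nonneg _) ?_
    rw [Real.norm_eq_abs, abs_le]
    constructor <;> linarith [gauss_le_one ht.1.le x, gauss_pos t x]

/-- Decomposition of the interaction over Gaussian scales, cut at `T`. -/
lemma g_eq {T : ℝ} (hT : 0 < T) {x : Space d} (hx : x ≠ 0) :
    g d x = selfEnergy d T - lowPart T x + highPart T x := by
  have hr : 0 < ‖x‖ := norm_pos_iff.mpr hx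
  have hr2 : 0 < ‖x‖ ^ 2 := by positivity
  by_cases h : d ≤ 2
  · -- After the substitution `u = t |x|²` only the integral of `1 / (2u)` between `1` and
    -- `T |x|²` survives.
    set M := ‖x‖ ^ 2 * T with hM
    have hM0 : 0 < M := by positivity
    have low : lowPart T x = ∫ u in (0 : ℝ)..M, (1 - Real.exp (-u)) / (2 * u) := by
      have := intervalIntegral.mul_integral_comp_mul_left (a := 0) (b := T)
        (f := fun u => (1 - Real.exp (-u)) / (2 * u)) (c := ‖x‖ ^ 2)
      rw [mul_zero] at this
      rw [hM, ← this, intervalIntegral.integral_of_le hT.le, ← integral_const_mul, lowPart]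
      refine setIntegral_congr_fun measurableSet_Ioc fun t ht => ?_
      have := ht.1
      simp only [scaleWeight, if_pos h, gauss]
      rw [show -(‖x‖ ^ 2 * t) = -t * ‖x‖ ^ 2 by ring]
      field_simp
    have high : highPart T x = ∫ u in Set.Ioi M, Real.exp (-u) / (2 * u) := by
      have := integral_comp_mul_left_Ioi (fun u => Real.exp (-u) / (2 * u)) T hr2
      rw [smul_eq_mul, eq_inv_mul_iff_mul_eq₀ hr2.ne'] at this
      rw [hM, ← this, ← integral_const_mul, highPart]
      refine setIntegral_congr_fun measurableSet_Ioi fun t ht => ?_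
      have : 0 < t := hT.trans ht
      simp only [scaleWeight, if_pos h, gauss]
      rw [show -(‖x‖ ^ 2 * t) = -t * ‖x‖ ^ 2 by ring]
      field_simp
    have s1 := intervalIntegral.integral_add_adjacent_intervals
      (intervalIntegrable_one_sub_exp_div le_rfl zero_le_one)
      (intervalIntegrable_one_sub_exp_div zero_le_one hM0.le)
    have s2 := intervalIntegral.integral_interval_add_Ioi (integrableOn_exp_div one_pos)
      (integrableOn_exp_div hM0)
    have i2 : IntervalIntegrable (fun u => Real.exp (-u) / (2 * u)) volume 1 M := by
      have hm : 0 < min 1 M := lt_min one_pos hM0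
      exact ⟨(integrableOn_exp_div hm).mono_set fun u hu => (min_le_left _ _).trans_lt hu.1,
        (integrableOn_exp_div hm).mono_set fun u hu => (min_le_right _ _).trans_lt hu.1⟩
    have s3 : (∫ u in (1 : ℝ)..M, (1 - Real.exp (-u)) / (2 * u)) +
        ∫ u in (1 : ℝ)..M, Real.exp (-u) / (2 * u) = Real.log M / 2 := by
      rw [← intervalIntegral.integral_add
        (intervalIntegrable_one_sub_exp_div zero_le_one hM0.le) i2]
      have : ∀ u : ℝ, (1 - Real.exp (-u)) / (2 * u) + Real.exp (-u) / (2 * u) = 2⁻¹ * u⁻¹ := by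
        intro u; rw [← add_div, sub_add_cancel, one_div, mul_inv]
      simp_rw [this]
      rw [intervalIntegral.integral_const_mul, integral_inv_of_pos one_pos hM0, div_one]
      ring
    have hlog : Real.log M = 2 * Real.log ‖x‖ + Real.log T := by
      rw [hM, Real.log_mul hr2.ne' hT.ne', Real.log_pow]; norm_num
    rw [g, if_pos h, low, high, selfEnergy, if_pos h]
    linarith
  · have hp := gamma_pos_of_three_le h
    have hG := Real.Gamma_pos_of_pos hp
    set p := (d : ℝ) / 2 - 1 with hpdef
    have hint := Real.integral_rpow_mul_exp_neg_mul_Ioi hp hr2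
    have hI : IntegrableOn (fun t : ℝ => t ^ (p - 1) * Real.exp (-(‖x‖ ^ 2 * t)))
        (Set.Ioi 0) := by
      by_contra hcon
      rw [integral_undef hcon] at hint
      have : 0 < (1 / ‖x‖ ^ 2) ^ p * Real.Gamma p := by positivity
      linarith
    have hfun : ∀ t : ℝ, scaleWeight d t * gauss t x =
        (t ^ (p - 1) * Real.exp (-(‖x‖ ^ 2 * t))) / Real.Gamma p := by
      intro t
      rw [scaleWeight, if_neg h, gauss, hpdef,
        show (d : ℝ) / 2 - 1 - 1 = (d : ℝ) / 2 - 2 by ring,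
        show -(‖x‖ ^ 2 * t) = -t * ‖x‖ ^ 2 by ring]
      ring
    have hI' : IntegrableOn (fun t => scaleWeight d t * gauss t x) (Set.Ioi 0) := by
      simp_rw [hfun]; exact hI.div_const _
    have htot : ∫ t in Set.Ioi (0 : ℝ), scaleWeight d t * gauss t x = g d x := by
      simp_rw [hfun]
      rw [integral_div, hint, g, if_neg h, mul_div_cancel_right₀ _ hG.ne', one_div,
        Real.inv_rpow hr2.le, ← Real.rpow_natCast, ← Real.rpow_mul hr.le, ← Real.rpow_neg hr.le]
      congr 1
      push_cast; rw [hpdef]; ring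
    have hsplit : (∫ t in Set.Ioc (0 : ℝ) T, scaleWeight d t * gauss t x) +
        highPart T x = g d x := by
      rw [← htot, highPart, ← setIntegral_union (Set.Ioc_disjoint_Ioi le_rfl) measurableSet_Ioi
        (hI'.mono_set fun t ht => ht.1) (hI'.mono_set fun t ht => hT.trans ht),
        Set.Ioc_union_Ioi_eq_Ioi hT.le]
    have hIw : IntegrableOn (scaleWeight d) (Set.Ioc 0 T) ∧
        ∫ t in Set.Ioc (0 : ℝ) T, scaleWeight d t = selfEnergy d T := by
      have : scaleWeight d = fun t => t ^ (p - 1) / Real.Gamma p := by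
        funext t
        rw [scaleWeight, if_neg h, hpdef, show (d : ℝ) / 2 - 1 - 1 = (d : ℝ) / 2 - 2 by ring]
      rw [this]
      refine ⟨Integrable.div_const
        (intervalIntegral.intervalIntegrable_rpow' (a := 0) (b := T) (by linarith)).1 _, ?_⟩
      rw [integral_div, ← intervalIntegral.integral_of_le hT.le,
        integral_rpow (Or.inl (by linarith)), sub_add_cancel, Real.zero_rpow hp.ne', sub_zero,
        selfEnergy, if_neg h, ← hpdef, div_div]
    have hlow : lowPart T x = selfEnergy d T -
        ∫ t in Set.Ioc (0 : ℝ) T, scaleWeight d t * gauss t x := by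
      rw [← hIw.2, ← integral_sub hIw.1 (hI'.mono_set fun t ht => ht.1), lowPart]
      simp_rw [mul_sub, mul_one]
    rw [hlow, ← hsplit]; ring

/-- The scales `t > T` have total mass of order `T^{-min(d/2, 1)}`, which decides the error made on
the potential of a measure of bounded density. -/
lemma exists_integral_highPart (hd : 1 ≤ d) : ∃ C : ℝ, 0 ≤ C ∧ ∀ T : ℝ, 0 < T →
    Integrable (highPart T : Space d → ℝ) ∧
      ∫ x : Space d, highPart T x = C * T ^ (-min ((d : ℝ) / 2) 1) := by
  -- The `x`-integral of the scale `t` is `K * t ^ (-q - 1)` with `q = min (d/2) 1`.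
  set q : ℝ := min ((d : ℝ) / 2) 1 with hq
  have hd' : (1 : ℝ) ≤ d := by exact_mod_cast hd
  have hq0 : 0 < q := lt_min (by positivity) one_pos
  obtain ⟨K, hK0, hK⟩ : ∃ K : ℝ, 0 ≤ K ∧ ∀ t : ℝ, 0 < t →
      scaleWeight d t * (Real.pi / t) ^ ((d : ℝ) / 2) = K * t ^ (-q - 1) := by
    by_cases h : d ≤ 2
    · refine ⟨2⁻¹ * Real.pi ^ ((d : ℝ) / 2), by positivity, fun t ht => ?_⟩
      have h2 : (d : ℝ) ≤ 2 := by exact_mod_cast h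
      have : q = (d : ℝ) / 2 := by rw [hq, min_eq_left]; linarith
      rw [this, scaleWeight, if_pos h, Real.div_rpow Real.pi_pos.le ht.le, sub_eq_add_neg,
        Real.rpow_add ht, Real.rpow_neg ht.le, Real.rpow_neg_one]
      field_simp
    · have h2 := gamma_pos_of_three_le h
      have hG := Real.Gamma_pos_of_pos h2
      refine ⟨Real.pi ^ ((d : ℝ) / 2) / Real.Gamma ((d : ℝ) / 2 - 1), by positivity,
        fun t ht => ?_⟩
      have : q = 1 := by rw [hq, min_eq_right]; linarith
      have e : t ^ ((d : ℝ) / 2 - 2) = t ^ ((d : ℝ) / 2) * t ^ (-1 - 1 : ℝ) := by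
        rw [← Real.rpow_add ht]; congr 1; ring
      have := Real.rpow_pos_of_pos ht ((d : ℝ) / 2)
      rw [‹q = 1›, scaleWeight, if_neg h, Real.div_rpow Real.pi_pos.le ht.le, e]
      field_simp
  refine ⟨K / q, by positivity, fun T hT => ?_⟩
  have hpow : IntegrableOn (fun t : ℝ => K * t ^ (-q - 1)) (Set.Ioi T) :=
    (integrableOn_Ioi_rpow_of_lt (by linarith) hT).const_mul K
  have hmeas : Measurable (Function.uncurry fun (t : ℝ) (x : Space d) =>
      scaleWeight d t * gauss t x) :=
    ((measurable_scaleWeight d).comp measurable_fst).mul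
      continuous_gauss_uncurry.measurable
  have hprod : Integrable (Function.uncurry fun (t : ℝ) (x : Space d) =>
      scaleWeight d t * gauss t x) ((volume.restrict (Set.Ioi T)).prod volume) := by
    rw [integrable_prod_iff hmeas.aestronglyMeasurable]
    constructor
    · refine (ae_restrict_mem measurableSet_Ioi).mono fun t ht => ?_
      exact (integrable_gauss (hT.trans ht)).const_mul (scaleWeight d t)
    · refine hpow.congr ((ae_restrict_mem measurableSet_Ioi).mono fun t ht => ?_)
      have ht0 : 0 < t := hT.trans ht
      simp only [Function.uncurry]
      rw [← hK t ht0, ← integral_gauss ht0, ← integral_const_mul]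
      refine integral_congr_ae (Eventually.of_forall fun x => ?_)
      exact (Real.norm_of_nonneg (mul_pos (scaleWeight_pos d ht0) (gauss_pos _ _)).le).symm
  refine ⟨hprod.integral_prod_right, ?_⟩
  have hswap := integral_integral_swap hprod
  simp only [highPart]
  rw [← hswap]
  calc ∫ t in Set.Ioi T, ∫ x : Space d, scaleWeight d t * gauss t x
      = ∫ t in Set.Ioi T, K * t ^ (-q - 1) := by
        refine setIntegral_congr_fun measurableSet_Ioi fun t ht => ?_
        rw [← hK t (hT.trans ht), ← integral_gauss (hT.trans ht), ← integral_const_mul]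
    _ = K / q * T ^ (-q) := by
        rw [integral_const_mul, integral_Ioi_rpow_of_lt (by linarith) hT]
        rw [sub_add_cancel]
        field_simp

/-! ### Tame measures and their potentials -/

/-- A probability measure with density at most `M` and, in the logarithmic cases, a finite
logarithmic moment. For such a measure all the interaction integrals converge. -/
structure IsTame (M : ℝ≥0) (μ : Measure (Space d)) : Prop where
  isProbabilityMeasure : IsProbabilityMeasure μ
  le_smul : μ ≤ M • (volume : Measure (Space d))
  integrable_log : d ≤ 2 → Integrable (fun x => Real.log (1 + ‖x‖)) μ

/-- The potential `g * μ` generated by `μ`. -/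
def potential (μ : Measure (Space d)) (x : Space d) : ℝ := ∫ y, g d (x - y) ∂μ

lemma measurable_g : Measurable (g d) := by
  unfold g
  split_ifs <;> fun_prop

lemma g_sub_comm (x y : Space d) : g d (x - y) = g d (y - x) := by
  simp only [g, norm_sub_rev x y]

lemma measurable_gauss_uncurry : Measurable fun p : ℝ × Space d => gauss p.1 p.2 :=
  continuous_gauss_uncurry.measurable

lemma measurable_highPart (T : ℝ) : Measurable (highPart T : Space d → ℝ) := by
  have : StronglyMeasurable fun p : Space d × ℝ => scaleWeight d p.2 * gauss p.2 p.1 :=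
    (((measurable_scaleWeight d).comp measurable_snd).mul
      (measurable_gauss_uncurry.comp measurable_swap)).stronglyMeasurable
  exact (this.integral_prod_right' (ν := volume.restrict (Set.Ioi T))).measurable

/-- A bound for the growth of `-g` at infinity: logarithmic if `d ≤ 2`, and zero if `d ≥ 3`. -/
def logGrowth (x : Space d) : ℝ := if d ≤ 2 then Real.log (1 + ‖x‖) else 0

lemma logGrowth_nonneg (x : Space d) : 0 ≤ logGrowth x := by
  unfold logGrowth
  split_ifs
  · exact Real.log_nonneg (by linarith [norm_nonneg x])
  · exact le_rfl

lemma log_one_add_norm_sub_le (x y : Space d) :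
    Real.log (1 + ‖x - y‖) ≤ Real.log (1 + ‖x‖) + Real.log (1 + ‖y‖) := by
  rw [← Real.log_mul (by positivity) (by positivity)]
  refine Real.log_le_log (by positivity) ?_
  nlinarith [norm_sub_le x y, norm_nonneg x, norm_nonneg y]

lemma logGrowth_sub_le (x y : Space d) : logGrowth (x - y) ≤ logGrowth x + logGrowth y := by
  unfold logGrowth
  split_ifs
  · exact log_one_add_norm_sub_le x y
  · simp

lemma neg_g_le (x : Space d) : -g d x ≤ logGrowth x := by
  unfold g logGrowth
  split_ifs
  · rw [neg_neg]
    rcases (norm_nonneg x).eq_or_lt with h | h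
    · rw [← h]; simp
    · exact Real.log_le_log h (by linarith)
  · have : 0 ≤ ‖x‖ ^ (2 - (d : ℝ)) := by positivity
    linarith

lemma g_le {x : Space d} (hx : x ≠ 0) : g d x ≤ |selfEnergy d 1| + highPart 1 x := by
  rw [g_eq one_pos hx]
  linarith [le_abs_self (selfEnergy d 1), lowPart_nonneg 1 x]

lemma abs_g_le {x : Space d} (hx : x ≠ 0) :
    |g d x| ≤ |selfEnergy d 1| + highPart 1 x + logGrowth x := by
  have h1 := g_le hx
  have h2 := neg_g_le x
  have h3 := logGrowth_nonneg x
  have h4 := highPart_nonneg zero_le_one x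
  have h5 := abs_nonneg (selfEnergy d 1)
  rw [abs_le]; constructor <;> linarith

lemma measurable_potential (μ : Measure (Space d)) [SFinite μ] : Measurable (potential μ) := by
  have : StronglyMeasurable fun p : Space d × Space d => g d (p.1 - p.2) :=
    (measurable_g.comp (by fun_prop)).stronglyMeasurable
  exact (this.integral_prod_right' (ν := μ)).measurable

namespace IsTame

lemma absolutelyContinuous (h : IsTame M μ) : μ ≪ volume :=
  (Measure.absolutelyContinuous_of_le h.le_smul).trans
    (Measure.AbsolutelyContinuous.rfl.smul_left M)

lemma integrable_logGrowth (h : IsTame M μ) : Integrable logGrowth μ := by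
  unfold logGrowth
  split_ifs with hd
  · exact h.integrable_log hd
  · exact integrable_zero _ _ _

lemma ae_ne (hd : 1 ≤ d) (h : IsTame M μ) (x : Space d) : ∀ᵐ y ∂μ, x - y ≠ 0 := by
  have : Nonempty (Fin d) := ⟨⟨0, hd⟩⟩
  refine h.absolutelyContinuous.ae_le ?_
  filter_upwards [Measure.ae_ne volume x] with y hy
  exact sub_ne_zero.mpr hy.symm

lemma ae_prod_ne (hd : 1 ≤ d) (h : IsTame M μ) (ν : Measure (Space d)) [SFinite ν] :
    ∀ᵐ p ∂ν.prod μ, p.1 - p.2 ≠ 0 := by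
  have := h.isProbabilityMeasure
  refine (Measure.ae_prod_iff_ae_ae ?_).mpr (Eventually.of_forall fun x => h.ae_ne hd x)
  exact (measurable_fst.sub measurable_snd) (measurableSet_singleton 0).compl

lemma integrable_highPart_sub (hd : 1 ≤ d) (h : IsTame M μ) {T : ℝ} (hT : 0 < T) (x : Space d) :
    Integrable (fun y => highPart T (x - y)) μ := by
  obtain ⟨C, -, hC⟩ := exists_integral_highPart hd
  exact (((hC T hT).1.comp_sub_left x).smul_measure_nnreal (c := M)).mono_measure h.le_smul

lemma integral_highPart_sub_le (hd : 1 ≤ d) (h : IsTame M μ) {T : ℝ} (hT : 0 < T) (x : Space d) :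
    ∫ y, highPart T (x - y) ∂μ ≤ M * ∫ y : Space d, highPart T y := by
  obtain ⟨C, -, hC⟩ := exists_integral_highPart hd
  have hi := ((hC T hT).1.comp_sub_left x).smul_measure_nnreal (c := M)
  refine (integral_mono_measure h.le_smul
    (Eventually.of_forall fun y => highPart_nonneg hT.le _) hi).trans_eq ?_
  rw [integral_smul_nnreal_measure, integral_sub_left_eq_self (fun y => highPart T y)]
  rfl

lemma integrable_g_sub (hd : 1 ≤ d) (h : IsTame M μ) (x : Space d) :
    Integrable (fun y => g d (x - y)) μ := by
  have := h.isProbabilityMeasure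
  refine Integrable.mono' (((integrable_const (|selfEnergy d 1| + logGrowth x)).add
    (h.integrable_highPart_sub hd one_pos x)).add h.integrable_logGrowth)
    (measurable_g.comp (by fun_prop)).aestronglyMeasurable ?_
  filter_upwards [h.ae_ne hd x] with y hy
  have := abs_g_le hy
  have := logGrowth_sub_le x y
  simp only [Pi.add_apply, Real.norm_eq_abs]
  linarith

lemma integrable_highPart_prod (hd : 1 ≤ d) (h : IsTame M μ) (ν : Measure (Space d))
    [IsFiniteMeasure ν] {T : ℝ} (hT : 0 < T) :
    Integrable (fun p => highPart T (p.1 - p.2)) (ν.prod μ) := by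
  have := h.isProbabilityMeasure
  have hm : Measurable fun p : Space d × Space d => highPart T (p.1 - p.2) :=
    (measurable_highPart T).comp (by fun_prop)
  rw [integrable_prod_iff hm.aestronglyMeasurable]
  refine ⟨Eventually.of_forall fun x => h.integrable_highPart_sub hd hT x, ?_⟩
  refine Integrable.of_bound (C := M * ∫ y : Space d, highPart T y)
    hm.norm.stronglyMeasurable.integral_prod_right'.aestronglyMeasurable
    (Eventually.of_forall fun x => ?_)
  rw [Real.norm_of_nonneg (integral_nonneg fun _ => norm_nonneg _)]
  simp_rw [Real.norm_of_nonneg (highPart_nonneg hT.le _)]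
  exact h.integral_highPart_sub_le hd hT x

lemma integrable_g_prod (hd : 1 ≤ d) (h : IsTame M μ) (h' : IsTame M' ν) :
    Integrable (fun p => g d (p.1 - p.2)) (ν.prod μ) := by
  have := h.isProbabilityMeasure
  have := h'.isProbabilityMeasure
  refine Integrable.mono' (((integrable_const |selfEnergy d 1|).add
    (h.integrable_highPart_prod hd ν one_pos)).add
    ((h'.integrable_logGrowth.comp_fst μ).add (h.integrable_logGrowth.comp_snd ν)))
    (measurable_g.comp (by fun_prop)).aestronglyMeasurable ?_
  filter_upwards [h.ae_prod_ne hd ν] with p hp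
  have := abs_g_le hp
  have := logGrowth_sub_le p.1 p.2
  simp only [Pi.add_apply, Real.norm_eq_abs]
  linarith

/-- The potential is bounded below by `-log(1+|x|)` up to a constant if `d ≤ 2`, and is
nonnegative if `d ≥ 3`. -/
lemma neg_potential_le (hd : 1 ≤ d) (h : IsTame M μ) (x : Space d) :
    -potential μ x ≤ logGrowth x + ∫ y, logGrowth y ∂μ := by
  have := h.isProbabilityMeasure
  rw [potential, ← integral_neg]
  have e : logGrowth x + ∫ y, logGrowth y ∂μ = ∫ y, (logGrowth x + logGrowth y) ∂μ := by
    rw [integral_add (integrable_const _) h.integrable_logGrowth]; simp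
  rw [e]
  refine integral_mono (h.integrable_g_sub hd x).neg
    ((integrable_const _).add h.integrable_logGrowth) fun y => ?_
  exact (neg_g_le _).trans (logGrowth_sub_le x y)

/-- The logarithmic moment is finite for a measure of finite interaction energy. -/
lemma of_integrable_g (hle : μ ≤ M • (volume : Measure (Space d))) [hp : IsProbabilityMeasure μ]
    (hg : Integrable (fun p : Space d × Space d => g d (p.1 - p.2)) (μ.prod μ)) :
    IsTame M μ := by
  refine ⟨hp, hle, fun hd => ?_⟩
  obtain ⟨y, hy⟩ := hg.prod_left_ae.exists
  simp only [g, if_pos hd] at hy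
  refine Integrable.mono' (((integrable_const (Real.log 2 + Real.log (1 + ‖y‖))).add hy.norm))
    (Measurable.aestronglyMeasurable (by fun_prop)) (Eventually.of_forall fun x => ?_)
  rw [Real.norm_of_nonneg (Real.log_nonneg (by linarith [norm_nonneg x]))]
  simp only [Pi.add_apply, norm_neg, Real.norm_eq_abs]
  have h1 : Real.log (1 + ‖x‖) ≤ Real.log (1 + ‖x - y‖) + Real.log (1 + ‖y‖) := by
    have := log_one_add_norm_sub_le (x - y) (-y)
    simpa using this
  have h2 : Real.log (1 + ‖x - y‖) ≤ Real.log 2 + |Real.log ‖x - y‖| := by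
    rcases le_total ‖x - y‖ 1 with h | h
    · have : Real.log (1 + ‖x - y‖) ≤ Real.log 2 :=
        Real.log_le_log (by positivity) (by linarith)
      linarith [abs_nonneg (Real.log ‖x - y‖)]
    · have : Real.log (1 + ‖x - y‖) ≤ Real.log (2 * ‖x - y‖) :=
        Real.log_le_log (by positivity) (by linarith)
      rw [Real.log_mul (by norm_num) (by linarith)] at this
      linarith [le_abs_self (Real.log ‖x - y‖)]
  linarith

end IsTame

/-! ### Splitting off the self-energy -/

lemma one_sub_gauss_nonneg {t : ℝ} (ht : 0 ≤ t) (x : Space d) : 0 ≤ 1 - gauss t x := by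
  linarith [gauss_le_one ht x]

/-- Fubini between the scale integral defining `lowPart` and a finite measure. -/
lemma integral_lowPart_comp {α : Type*} [MeasurableSpace α] (ρ : Measure α) [IsFiniteMeasure ρ]
    {f : α → Space d} (hf : Measurable f) {T : ℝ}
    (hi : Integrable (fun ω => lowPart T (f ω)) ρ) :
    IntegrableOn (fun t => scaleWeight d t * ∫ ω, (1 - gauss t (f ω)) ∂ρ) (Set.Ioc 0 T) ∧
      ∫ t in Set.Ioc 0 T, scaleWeight d t * ∫ ω, (1 - gauss t (f ω)) ∂ρ
        = ∫ ω, lowPart T (f ω) ∂ρ := by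
  have hm : Measurable (Function.uncurry fun (ω : α) (t : ℝ) =>
      scaleWeight d t * (1 - gauss t (f ω))) :=
    ((measurable_scaleWeight d).comp measurable_snd).mul (measurable_const.sub
      (measurable_gauss_uncurry.comp (measurable_snd.prodMk (hf.comp measurable_fst))))
  have hprod : Integrable (Function.uncurry fun (ω : α) (t : ℝ) =>
      scaleWeight d t * (1 - gauss t (f ω))) (ρ.prod (volume.restrict (Set.Ioc 0 T))) := by
    rw [integrable_prod_iff hm.aestronglyMeasurable]
    refine ⟨Eventually.of_forall fun ω => integrableOn_low T (f ω), hi.congr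
      (Eventually.of_forall fun ω => ?_)⟩
    refine setIntegral_congr_fun measurableSet_Ioc fun t ht => ?_
    exact (Real.norm_of_nonneg (mul_nonneg (scaleWeight_pos d ht.1).le
      (one_sub_gauss_nonneg ht.1.le _))).symm
  have hswap := integral_integral_swap hprod
  have hright := hprod.integral_prod_right
  simp only [Function.uncurry, integral_const_mul] at hright hswap
  exact ⟨hright, hswap.symm⟩

lemma IsTame.integrable_lowPart_sub (hd : 1 ≤ d) (h : IsTame M μ) {T : ℝ} (hT : 0 < T)
    (x : Space d) :
    Integrable (fun y => lowPart T (x - y)) μ ∧ ∫ y, lowPart T (x - y) ∂μ =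
      selfEnergy d T - potential μ x + ∫ y, highPart T (x - y) ∂μ := by
  have := h.isProbabilityMeasure
  have hg := h.integrable_g_sub hd x
  have hh := h.integrable_highPart_sub hd hT x
  have e : (fun y => lowPart T (x - y)) =ᵐ[μ]
      fun y => selfEnergy d T - g d (x - y) + highPart T (x - y) := by
    filter_upwards [h.ae_ne hd x] with y hy
    rw [g_eq hT hy]; ring
  have hs : Integrable (fun y => selfEnergy d T - g d (x - y)) μ := (integrable_const _).sub hg
  refine ⟨(hs.add hh).congr e.symm, ?_⟩
  rw [integral_congr_ae e, integral_add hs hh, integral_sub (integrable_const _) hg, potential]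
  simp

lemma IsTame.integrable_lowPart_prod (hd : 1 ≤ d) (h : IsTame M μ) {T : ℝ} (hT : 0 < T) :
    Integrable (fun p => lowPart T (p.1 - p.2)) (μ.prod μ) ∧
    ∫ p, lowPart T (p.1 - p.2) ∂(μ.prod μ) = selfEnergy d T
      - ∫ p, g d (p.1 - p.2) ∂(μ.prod μ) + ∫ p, highPart T (p.1 - p.2) ∂(μ.prod μ) := by
  have := h.isProbabilityMeasure
  have hg := h.integrable_g_prod hd h
  have hh := h.integrable_highPart_prod hd μ hT
  have e : (fun p : Space d × Space d => lowPart T (p.1 - p.2)) =ᵐ[μ.prod μ]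
      fun p => selfEnergy d T - g d (p.1 - p.2) + highPart T (p.1 - p.2) := by
    filter_upwards [h.ae_prod_ne hd μ] with p hp
    rw [g_eq hT hp]; ring
  have hs : Integrable (fun p : Space d × Space d => selfEnergy d T - g d (p.1 - p.2))
    (μ.prod μ) := (integrable_const _).sub hg
  refine ⟨(hs.add hh).congr e.symm, ?_⟩
  rw [integral_congr_ae e, integral_add hs hh, integral_sub (integrable_const _) hg]
  simp

lemma gaussEnergy_eq (μ : Measure (Space d)) [IsProbabilityMeasure μ] {t : ℝ} (ht : 0 < t)
    {N : ℕ} (X : Fin N → Space d) :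
    gaussEnergy t μ X = -(∑ i, ∑ j, (1 - gauss t (X i - X j)))
      + 2 * N * ∑ i, ∫ y, (1 - gauss t (X i - y)) ∂μ
      - (N : ℝ) ^ 2 * ∫ p, (1 - gauss t (p.1 - p.2)) ∂(μ.prod μ) := by
  have h1 : ∀ i, ∫ y, (1 - gauss t (X i - y)) ∂μ = 1 - ∫ y, gauss t (X i - y) ∂μ := fun i => by
    rw [integral_sub (integrable_const _) (integrable_gauss_sub ht.le μ _)]; simp
  have h2 : ∫ p, (1 - gauss t (p.1 - p.2)) ∂(μ.prod μ) = 1 - gaussPairing t μ μ := by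
    rw [integral_sub (integrable_const _) (integrable_gauss_prod ht.le _),
      gaussPairing_eq_prod ht.le]; simp
  simp only [h1, h2, gaussEnergy, Finset.sum_sub_distrib, Finset.sum_const, Finset.card_univ,
    Fintype.card_fin, nsmul_eq_mul]
  ring

/-- The energy of `∑ i, δ_{x_i} - N μ` for the interaction truncated to the scales `t ≤ T`. -/
def truncatedEnergy (T : ℝ) (μ : Measure (Space d)) {N : ℕ} (X : Fin N → Space d) : ℝ :=
  ∫ t in Set.Ioc 0 T, scaleWeight d t * gaussEnergy t μ X

lemma IsTame.truncatedEnergy_eq (hd : 1 ≤ d) (h : IsTame M μ) {T : ℝ} (hT : 0 < T) {N : ℕ}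
    (X : Fin N → Space d) :
    IntegrableOn (fun t => scaleWeight d t * gaussEnergy t μ X) (Set.Ioc 0 T) ∧
    truncatedEnergy T μ X = -(∑ i, ∑ j, lowPart T (X i - X j))
      + 2 * N * ∑ i, ∫ y, lowPart T (X i - y) ∂μ
      - (N : ℝ) ^ 2 * ∫ p, lowPart T (p.1 - p.2) ∂(μ.prod μ) := by
  have := h.isProbabilityMeasure
  have e : Set.EqOn (fun t => scaleWeight d t * gaussEnergy t μ X)
      (fun t => -(∑ i, ∑ j, scaleWeight d t * (1 - gauss t (X i - X j)))
        + 2 * N * ∑ i, scaleWeight d t * ∫ y, (1 - gauss t (X i - y)) ∂μ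
        - (N : ℝ) ^ 2 * (scaleWeight d t * ∫ p, (1 - gauss t (p.1 - p.2)) ∂(μ.prod μ)))
      (Set.Ioc 0 T) := by
    intro t ht
    simp only
    rw [gaussEnergy_eq μ ht.1]
    simp only [← Finset.mul_sum]
    ring
  have i1 : ∀ i j, Integrable (fun t => scaleWeight d t * (1 - gauss t (X i - X j)))
      (volume.restrict (Set.Ioc 0 T)) := fun i j => integrableOn_low T _
  have i2 : ∀ i, _ := fun i => integral_lowPart_comp μ (f := fun y => X i - y) (by fun_prop)
    (h.integrable_lowPart_sub hd hT (X i)).1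
  have i3 := integral_lowPart_comp (μ.prod μ) (f := fun p => p.1 - p.2) (by fun_prop)
    (h.integrable_lowPart_prod hd hT).1
  have j1 : Integrable (fun t => -∑ i, ∑ j, scaleWeight d t * (1 - gauss t (X i - X j)))
      (volume.restrict (Set.Ioc 0 T)) := (integrable_finsetSum Finset.univ fun i _ =>
    integrable_finsetSum Finset.univ fun j _ => i1 i j).neg
  have j2 := (integrable_finsetSum Finset.univ fun i _ => (i2 i).1).const_mul (2 * (N : ℝ))
  have j3 := i3.1.const_mul ((N : ℝ) ^ 2)
  have j12 : Integrable (fun t => -(∑ i, ∑ j, scaleWeight d t * (1 - gauss t (X i - X j)))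
        + 2 * N * ∑ i, scaleWeight d t * ∫ y, (1 - gauss t (X i - y)) ∂μ)
      (volume.restrict (Set.Ioc 0 T)) := j1.add j2
  refine ⟨IntegrableOn.congr_fun (j12.sub j3) e.symm measurableSet_Ioc, ?_⟩
  rw [truncatedEnergy, setIntegral_congr_fun measurableSet_Ioc e]
  rw [integral_sub j12 j3, integral_add j1 j2, integral_neg, integral_const_mul,
    integral_const_mul, i3.2, integral_finsetSum _ fun i _ => (i2 i).1,
    integral_finsetSum _ fun i _ => integrable_finsetSum Finset.univ fun j _ => i1 i j]
  simp_rw [fun i => (i2 i).2, fun i => integral_finsetSum Finset.univ fun j _ => i1 i j]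
  rfl

lemma sum_offDiag_eq {ι : Type*} [Fintype ι] [DecidableEq ι] (F : ι → ι → ℝ) :
    ∑ p ∈ (Finset.univ : Finset ι).offDiag, F p.1 p.2 = ∑ i, ∑ j, F i j - ∑ i, F i i := by
  have h := Finset.sum_union (Finset.disjoint_diag_offDiag (Finset.univ : Finset ι))
    (f := fun p : ι × ι => F p.1 p.2)
  rw [Finset.diag_union_offDiag, Finset.sum_product, Finset.sum_diag] at h
  linarith

/-- Splitting off the self-interactions of the truncated kernel bounds the interaction energy of
distinct points from below by its mean-field value. -/
lemma IsTame.sum_g_ge (hd : 1 ≤ d) (h : IsTame M μ) {T : ℝ} (hT : 0 < T) {N : ℕ}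
    {X : Fin N → Space d} (hX : ∀ i j, i ≠ j → X i ≠ X j) :
    2 * N * ∑ i, potential μ (X i) - (N : ℝ) ^ 2 * ∫ p, g d (p.1 - p.2) ∂(μ.prod μ)
      - N * selfEnergy d T - 2 * (N : ℝ) ^ 2 * (M * ∫ x : Space d, highPart T x)
      + truncatedEnergy T μ X
    ≤ ∑ p ∈ (Finset.univ : Finset (Fin N)).offDiag, g d (X p.1 - X p.2) := by
  have hlow : ∑ p ∈ (Finset.univ : Finset (Fin N)).offDiag, lowPart T (X p.1 - X p.2)
      = ∑ i, ∑ j, lowPart T (X i - X j) := by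
    rw [sum_offDiag_eq fun i j => lowPart T (X i - X j)]
    simp [lowPart_zero]
  have hcard : ((Finset.univ : Finset (Fin N)).offDiag.card : ℝ) = (N : ℝ) ^ 2 - N := by
    rw [Finset.offDiag_card, Finset.card_univ, Fintype.card_fin,
      Nat.cast_sub (Nat.le_mul_self N)]
    push_cast; ring
  have h1 : ∑ p ∈ (Finset.univ : Finset (Fin N)).offDiag, (selfEnergy d T
      - lowPart T (X p.1 - X p.2)) ≤
      ∑ p ∈ (Finset.univ : Finset (Fin N)).offDiag, g d (X p.1 - X p.2) := by
    refine Finset.sum_le_sum fun p hp => ?_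
    have hp' := (Finset.mem_offDiag.mp hp).2.2
    rw [g_eq hT (sub_ne_zero.mpr (hX _ _ hp'))]
    linarith [highPart_nonneg hT.le (X p.1 - X p.2)]
  rw [Finset.sum_sub_distrib, Finset.sum_const, nsmul_eq_mul, hcard, hlow] at h1
  have h2 := (h.truncatedEnergy_eq hd hT X).2
  have h3 : ∑ i, ∫ y, lowPart T (X i - y) ∂μ ≤ ∑ i, (selfEnergy d T - potential μ (X i)
      + M * ∫ x : Space d, highPart T x) :=
    Finset.sum_le_sum fun i _ => by
      rw [(h.integrable_lowPart_sub hd hT (X i)).2]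
      linarith [h.integral_highPart_sub_le hd hT (X i)]
  rw [Finset.sum_add_distrib, Finset.sum_sub_distrib, Finset.sum_const, Finset.sum_const,
    Finset.card_univ, Fintype.card_fin, nsmul_eq_mul, nsmul_eq_mul] at h3
  have h4 := (h.integrable_lowPart_prod hd hT).2
  have h5 : 0 ≤ ∫ p, highPart T (p.1 - p.2) ∂(μ.prod μ) :=
    integral_nonneg fun p => highPart_nonneg hT.le _
  have h6 := mul_le_mul_of_nonneg_left h3 (by positivity : (0 : ℝ) ≤ 2 * N)
  have h7 := mul_nonneg (sq_nonneg (N : ℝ)) h5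
  rw [h4] at h2
  nlinarith

/-! ### The truncated energy controls linear statistics -/

lemma continuousOn_scaleWeight (d : ℕ) : ContinuousOn (scaleWeight d) (Set.Ioi 0) := by
  unfold scaleWeight
  split_ifs
  · exact ContinuousOn.inv₀ (by fun_prop) fun t ht => by
      have : 0 < t := ht
      positivity
  · exact ContinuousOn.div_const (fun t ht =>
      (Real.continuousAt_rpow_const t _ (Or.inl (ne_of_gt ht))).continuousWithinAt) _

lemma gauss_half_mul (t : ℝ) (x : Space d) : gauss t x = gauss (t / 2) x * gauss (t / 2) x := by
  simp only [gauss, ← Real.exp_add]; congr 1; ring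

lemma integrable_gauss_mul {h : Space d → ℝ} (hc : Continuous h) (hs : HasCompactSupport h)
    (t : ℝ) (x : Space d) : Integrable fun y => gauss t (x - y) * h y :=
  Continuous.integrable_of_hasCompactSupport
    (((continuous_gauss t).comp (by fun_prop)).mul hc) hs.mul_left

lemma abs_mul_le_of_integral_gauss {c t : ℝ} (hc : 0 ≤ c) (ht : 0 < t)
    (hct : c * ∫ y : Space d, gauss t y = 1) {F : Space d → ℝ} {ε B δ : ℝ} (hε : 0 ≤ ε)
    (hB : 0 ≤ B) (x : Space d) (hF : Integrable fun y => gauss t (x - y) * F y)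
    (h1 : ∀ y, ‖x - y‖ < δ → |F y| ≤ ε) (h2 : ∀ y, |F y| ≤ B) (hδ : 0 ≤ δ) :
    |c * ∫ y, gauss t (x - y) * F y| ≤
      ε + B * (2 ^ ((d : ℝ) / 2) * Real.exp (-(t / 2) * δ ^ 2)) := by
  have it : Integrable fun y => gauss t (x - y) := (integrable_gauss ht).comp_sub_left x
  have it2 : Integrable fun y => gauss (t / 2) (x - y) :=
    (integrable_gauss (half_pos ht)).comp_sub_left x
  have hb : ∀ y, |gauss t (x - y) * F y| ≤ ε * gauss t (x - y)
      + B * Real.exp (-(t / 2) * δ ^ 2) * gauss (t / 2) (x - y) := by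
    intro y
    have hg := gauss_pos t (x - y)
    have hg2 := gauss_pos (t / 2) (x - y)
    have he := Real.exp_pos (-(t / 2) * δ ^ 2)
    rw [abs_mul, abs_of_pos hg]
    rcases lt_or_ge ‖x - y‖ δ with h | h
    · have := mul_le_mul_of_nonneg_left (h1 y h) hg.le
      have : 0 ≤ B * Real.exp (-(t / 2) * δ ^ 2) * gauss (t / 2) (x - y) := by positivity
      linarith
    · have e1 : gauss (t / 2) (x - y) ≤ Real.exp (-(t / 2) * δ ^ 2) := by
        rw [gauss, Real.exp_le_exp]
        nlinarith [pow_le_pow_left₀ hδ h 2]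
      have : gauss t (x - y) * |F y| ≤ B * Real.exp (-(t / 2) * δ ^ 2) * gauss (t / 2) (x - y) :=
        calc gauss t (x - y) * |F y| ≤ gauss t (x - y) * B :=
              mul_le_mul_of_nonneg_left (h2 y) hg.le
          _ = B * gauss (t / 2) (x - y) * gauss (t / 2) (x - y) := by
              rw [gauss_half_mul]; ring
          _ ≤ B * Real.exp (-(t / 2) * δ ^ 2) * gauss (t / 2) (x - y) := by gcongr
      have : 0 ≤ ε * gauss t (x - y) := by positivity
      linarith
  have hint : ∫ y, gauss (t / 2) (x - y) = 2 ^ ((d : ℝ) / 2) * ∫ y : Space d, gauss t y := by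
    rw [integral_sub_left_eq_self (fun y => gauss (t / 2) y), integral_gauss (half_pos ht),
      integral_gauss ht, ← Real.mul_rpow (by norm_num) (by positivity)]
    congr 1; field_simp
  calc |c * ∫ y, gauss t (x - y) * F y| = c * |∫ y, gauss t (x - y) * F y| := by
        rw [abs_mul, abs_of_nonneg hc]
    _ ≤ c * ∫ y, (ε * gauss t (x - y)
          + B * Real.exp (-(t / 2) * δ ^ 2) * gauss (t / 2) (x - y)) := by
        refine mul_le_mul_of_nonneg_left ?_ hc
        exact abs_integral_le_integral_abs.trans (integral_mono hF.abs
          ((it.const_mul _).add (it2.const_mul _)) hb)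
    _ = ε * (c * ∫ y : Space d, gauss t y) + B * Real.exp (-(t / 2) * δ ^ 2) *
          2 ^ ((d : ℝ) / 2) * (c * ∫ y : Space d, gauss t y) := by
        rw [integral_add (it.const_mul _) (it2.const_mul _), integral_const_mul,
          integral_const_mul, hint, integral_sub_left_eq_self (fun y => gauss t y)]
        ring
    _ = _ := by rw [hct]; ring

/-- Normalized Gaussians form an approximate identity, uniformly on `C_c`. -/
lemma exists_gauss_approx {h : Space d → ℝ} (hc : Continuous h) (hs : HasCompactSupport h)
    {ε : ℝ} (hε : 0 < ε) : ∃ s : ℝ, 0 < s ∧ ∀ t, s ≤ t → ∀ x,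
      |(Real.pi / t) ^ (-((d : ℝ) / 2)) * (∫ y, gauss t (x - y) * h y) - h x| ≤ ε := by
  obtain ⟨δ, hδ, hu⟩ := Metric.uniformContinuous_iff.mp (hs.uniformContinuous_of_continuous hc)
    (ε / 2) (half_pos hε)
  obtain ⟨B, hB⟩ := hs.exists_bound_of_continuous hc
  have hB0 : 0 ≤ B := (norm_nonneg _).trans (hB 0)
  have hlim : Tendsto (fun t : ℝ => 2 * B * (2 ^ ((d : ℝ) / 2) * Real.exp (-(t / 2) * δ ^ 2)))
      atTop (𝓝 0) := by
    have : Tendsto (fun t : ℝ => -(t / 2) * δ ^ 2) atTop atBot := by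
      have : (fun t : ℝ => -(t / 2) * δ ^ 2) = fun t => t * (-(δ ^ 2 / 2)) := by
        funext t; ring
      rw [this]
      exact tendsto_id.atTop_mul_const_of_neg (by have := pow_pos hδ 2; linarith)
    have := ((Real.tendsto_exp_atBot.comp this).const_mul (2 ^ ((d : ℝ) / 2) : ℝ)).const_mul
      (2 * B)
    simpa using this
  obtain ⟨s, hs1⟩ := (hlim.eventually (gt_mem_nhds (half_pos hε))).exists_forall_of_atTop
  refine ⟨max s 1, lt_max_of_lt_right one_pos, fun t ht x => ?_⟩
  have ht0 : 0 < t := one_pos.trans_le ((le_max_right _ _).trans ht)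
  have hpt : 0 < Real.pi / t := by positivity
  have hct : (Real.pi / t) ^ (-((d : ℝ) / 2)) * ∫ y : Space d, gauss t y = 1 := by
    rw [integral_gauss ht0, ← Real.rpow_add hpt]; simp
  have it : Integrable fun y => gauss t (x - y) := (integrable_gauss ht0).comp_sub_left x
  have ih := integrable_gauss_mul hc hs t x
  have hF : Integrable fun y => gauss t (x - y) * (h y - h x) := by
    simp_rw [mul_sub]; exact ih.sub (it.mul_const _)
  have key := abs_mul_le_of_integral_gauss (c := (Real.pi / t) ^ (-((d : ℝ) / 2)))
    (by positivity) ht0 hct (F := fun y => h y - h x) (ε := ε / 2) (B := 2 * B) (δ := δ)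
    (half_pos hε).le (by positivity) x hF
    (fun y hy => by
      have := hu (a := x) (b := y) (by rwa [dist_eq_norm])
      rw [dist_comm, Real.dist_eq] at this; exact this.le)
    (fun y => by
      have h1 := hB y
      have h2 := hB x
      rw [Real.norm_eq_abs] at h1 h2
      exact (abs_sub _ _).trans (by linarith)) hδ.le
  have e : (Real.pi / t) ^ (-((d : ℝ) / 2)) * ∫ y, gauss t (x - y) * (h y - h x) =
      (Real.pi / t) ^ (-((d : ℝ) / 2)) * (∫ y, gauss t (x - y) * h y) - h x := by
    simp_rw [mul_sub]
    rw [integral_sub ih (it.mul_const _), integral_mul_const,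
      integral_sub_left_eq_self (fun y => gauss t y), mul_sub, ← mul_assoc, hct, one_mul]
  rw [e] at key
  have := hs1 t ((le_max_left _ _).trans ht)
  linarith

lemma gaussPairing_self_le {t : ℝ} (ht : 0 ≤ t) (η : Measure (Space d)) [IsFiniteMeasure η] :
    gaussPairing t η η ≤ (η.real Set.univ) ^ 2 := by
  rw [gaussPairing_eq_prod ht]
  calc ∫ p, gauss t (p.1 - p.2) ∂(η.prod η) ≤ ∫ _p, (1 : ℝ) ∂(η.prod η) :=
        integral_mono (integrable_gauss_prod ht _) (integrable_const _)
          fun p => gauss_le_one ht _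
    _ = (η.real Set.univ) ^ 2 := by
        rw [integral_const, smul_eq_mul, mul_one, measureReal_def, ← Set.univ_prod_univ,
          Measure.prod_prod, ENNReal.toReal_mul, sq]; rfl

/-- At all scales beyond some `s`, the Gaussian energy controls linear statistics of a
nonnegative `h ∈ C_c`. -/
lemma exists_gaussEnergy_ge (μ : Measure (Space d)) [IsProbabilityMeasure μ] {h : Space d → ℝ}
    (hc : Continuous h) (hs : HasCompactSupport h) (h0 : ∀ x, 0 ≤ h x) {ε : ℝ} (hε : 0 < ε) :
    ∃ s D : ℝ, 0 < s ∧ 0 ≤ D ∧ ∀ t, s ≤ t → t ≤ 2 * s → ∀ (N : ℕ) (X : Fin N → Space d) (a : ℝ),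
      0 ≤ a → 2 * a * (∑ i, h (X i) - N * ∫ x, h x ∂μ - 2 * ε * N) - a ^ 2 * D
        ≤ gaussEnergy t μ X := by
  obtain ⟨s, hs0, hsa⟩ := exists_gauss_approx hc hs hε
  have ih : Integrable h := hc.integrable_of_hasCompactSupport hs
  have ihμ : Integrable h μ := hc.integrable_of_hasCompactSupport hs
  set D0 : ℝ := (Real.pi / (2 * s)) ^ (-((d : ℝ) / 2)) * ∫ x, h x
  refine ⟨s, D0 ^ 2, hs0, sq_nonneg _, fun t hst hts N X a ha => ?_⟩
  have ht0 : 0 < t := hs0.trans_le hst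
  set c : ℝ := (Real.pi / t) ^ (-((d : ℝ) / 2)) with hcdef
  have hc0 : 0 ≤ c := by positivity
  have ich : Integrable fun y => c * h y := ih.const_mul c
  have hch0 : 0 ≤ᵐ[volume] fun y => c * h y := Eventually.of_forall fun y => mul_nonneg hc0 (h0 y)
  let η : Measure (Space d) := volume.withDensity fun y => ENNReal.ofReal (c * h y)
  have : IsFiniteMeasure η := isFiniteMeasure_withDensity_ofReal ich.2
  have hη : ∀ f : Space d → ℝ, ∫ y, f y ∂η = c * ∫ y, f y * h y := by
    intro f
    rw [integral_withDensity_eq_integral_toReal_smul (by fun_prop)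
      (Eventually.of_forall fun _ => ENNReal.ofReal_lt_top), ← integral_const_mul]
    refine integral_congr_ae (Eventually.of_forall fun y => ?_)
    simp only [ENNReal.toReal_ofReal (mul_nonneg hc0 (h0 y)), smul_eq_mul]
    ring
  have happ : ∀ x, |(∫ y, gauss t (x - y) ∂η) - h x| ≤ ε := fun x => by
    rw [hη]; exact hsa t hst x
  have hpair : gaussPairing t μ η ≤ ∫ x, h x ∂μ + ε := by
    rw [gaussPairing_eq_prod ht0.le, integral_prod _ (integrable_gauss_prod ht0.le _)]
    have e : ∫ x, h x ∂μ + ε = ∫ x, (h x + ε) ∂μ := by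
      rw [integral_add ihμ (integrable_const _)]; simp
    rw [e]
    refine integral_mono (integrable_gauss_prod ht0.le (μ.prod η)).integral_prod_left
      (ihμ.add (integrable_const _)) fun x => ?_
    have := (abs_le.mp (happ x)).2
    simp only
    linarith
  have hself : gaussPairing t η η ≤ D0 ^ 2 := by
    refine (gaussPairing_self_le ht0.le η).trans ?_
    have e : η.real Set.univ = c * ∫ y, h y := by
      have := hη fun _ => 1
      simpa using this
    rw [e]
    have hi : 0 ≤ ∫ y, h y := integral_nonneg h0
    refine pow_le_pow_left₀ (by positivity) (mul_le_mul_of_nonneg_right ?_ hi) 2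
    rw [hcdef, Real.rpow_neg (by positivity), Real.rpow_neg (by positivity)]
    gcongr
  have hsum : ∑ i, h (X i) - N * ε ≤ ∑ i, ∫ y, gauss t (X i - y) ∂η := by
    have : ∑ i, (h (X i) - ε) ≤ ∑ i, ∫ y, gauss t (X i - y) ∂η :=
      Finset.sum_le_sum fun i _ => by linarith [(abs_le.mp (happ (X i))).1]
    simpa [Finset.sum_sub_distrib] using this
  refine le_trans ?_ (gaussEnergy_ge ht0 μ η a X)
  have hN : (0 : ℝ) ≤ N := Nat.cast_nonneg N
  have h1 := mul_le_mul_of_nonneg_left hpair hN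
  have h2 := mul_le_mul_of_nonneg_left hself (sq_nonneg a)
  have h3 : ∑ i, h (X i) - N * ∫ x, h x ∂μ - 2 * ε * N ≤
      ∑ i, ∫ y, gauss t (X i - y) ∂η - N * gaussPairing t μ η := by linarith
  have h4 := mul_le_mul_of_nonneg_left h3 (by positivity : 0 ≤ 2 * a)
  linarith

/-- The truncated energy controls linear statistics of a nonnegative `h ∈ C_c`. -/
lemma IsTame.exists_truncatedEnergy_ge (hd : 1 ≤ d) (hμ : IsTame M μ) {h : Space d → ℝ}
    (hc : Continuous h) (hs : HasCompactSupport h) (h0 : ∀ x, 0 ≤ h x) {ε : ℝ} (hε : 0 < ε) :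
    ∃ K T₀ : ℝ, 0 < T₀ ∧ ∀ T, T₀ ≤ T → ∀ (N : ℕ) (X : Fin N → Space d) (a : ℝ), 0 ≤ a →
      2 * a * (∑ i, h (X i) - N * ∫ x, h x ∂μ - 2 * ε * N) - K * a ^ 2
        ≤ truncatedEnergy T μ X := by
  have := hμ.isProbabilityMeasure
  obtain ⟨s, D, hs0, hD, H⟩ := exists_gaussEnergy_ge μ hc hs h0 hε
  have hsub : Set.Icc s (2 * s) ⊆ Set.Ioi 0 := fun t ht => hs0.trans_le ht.1
  have hwi : IntervalIntegrable (scaleWeight d) volume s (2 * s) := by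
    refine ContinuousOn.intervalIntegrable ((continuousOn_scaleWeight d).mono ?_)
    rwa [Set.uIcc_of_le (by linarith)]
  set w : ℝ := ∫ t in s..2 * s, scaleWeight d t with hw
  have hw0 : 0 < w := intervalIntegral.intervalIntegral_pos_of_pos_on hwi
    (fun t ht => scaleWeight_pos d (hs0.trans ht.1)) (by linarith)
  refine ⟨D / w, 2 * s, by positivity, fun T hT N X a ha => ?_⟩
  have hT0 : 0 < T := by linarith
  have hi := (hμ.truncatedEnergy_eq hd hT0 X).1
  have hss : Set.Ioc s (2 * s) ⊆ Set.Ioc 0 T := Set.Ioc_subset_Ioc hs0.le hT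
  set b := 2 * (a / w) * (∑ i, h (X i) - N * ∫ x, h x ∂μ - 2 * ε * N) - (a / w) ^ 2 * D with hb
  calc 2 * a * (∑ i, h (X i) - N * ∫ x, h x ∂μ - 2 * ε * N) - D / w * a ^ 2
      = ∫ t in Set.Ioc s (2 * s), scaleWeight d t * b := by
        rw [integral_mul_const, ← intervalIntegral.integral_of_le (by linarith), ← hw, hb]
        field_simp
    _ ≤ ∫ t in Set.Ioc s (2 * s), scaleWeight d t * gaussEnergy t μ X := by
        refine setIntegral_mono_on (hwi.1.mul_const b) (hi.mono_set hss) measurableSet_Ioc ?_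
        intro t ht
        exact mul_le_mul_of_nonneg_left (H t ht.1.le ht.2 N X (a / w) (by positivity))
          (scaleWeight_pos d (hs0.trans ht.1)).le
    _ ≤ truncatedEnergy T μ X := by
        refine setIntegral_mono_set hi ?_ (LE.le.eventuallyLE hss)
        refine (ae_restrict_mem measurableSet_Ioc).mono fun t ht => ?_
        exact mul_nonneg (scaleWeight_pos d ht.1).le (gaussEnergy_nonneg ht.1 μ X)

/-! ### Euler–Lagrange conditions -/

/-- The effective potential `ζ = 2 g * μ + V - c`, normalized to have zero `μ`-average. -/
def effectivePotential (V : Space d → ℝ) (μ : Measure (Space d)) (x : Space d) : ℝ :=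
  2 * potential μ x + V x -
    (2 * ∫ p : Space d × Space d, g d (p.1 - p.2) ∂(μ.prod μ) + ∫ y, V y ∂μ)

/-- The interaction energy of two measures. -/
def interaction (ν ν' : Measure (Space d)) : ℝ := ∫ x, potential ν' x ∂ν

lemma measurable_effectivePotential (hV : Continuous V) (μ : Measure (Space d)) [SFinite μ] :
    Measurable (effectivePotential V μ) :=
  (((measurable_potential μ).const_mul 2).add hV.measurable).sub_const _

namespace IsTame

lemma interaction_eq (hd : 1 ≤ d) (h : IsTame M μ) (h' : IsTame M' ν) :
    interaction ν μ = ∫ p, g d (p.1 - p.2) ∂(ν.prod μ) := by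
  have := h.isProbabilityMeasure
  have := h'.isProbabilityMeasure
  rw [interaction, integral_prod _ (h.integrable_g_prod hd h')]
  rfl

lemma integrable_potential (hd : 1 ≤ d) (h : IsTame M μ) (h' : IsTame M' ν) :
    Integrable (potential μ) ν := by
  have := h.isProbabilityMeasure
  have := h'.isProbabilityMeasure
  exact (h.integrable_g_prod hd h').integral_prod_left

lemma interaction_comm (hd : 1 ≤ d) (h : IsTame M μ) (h' : IsTame M' ν) :
    interaction ν μ = interaction μ ν := by
  have := h.isProbabilityMeasure
  have := h'.isProbabilityMeasure
  simp only [interaction, potential]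
  rw [integral_integral_swap (h.integrable_g_prod hd h')]
  simp_rw [fun x y : Space d => g_sub_comm x y]

lemma convexCombination (h : IsTame M μ) (h' : IsTame M' ν) {s t : ℝ≥0} (hst : s + t = 1) :
    IsTame (s * M + t * M') (s • μ + t • ν) := by
  have := h.isProbabilityMeasure
  have := h'.isProbabilityMeasure
  refine ⟨⟨?_⟩, ?_, fun hd => ?_⟩
  · simp only [Measure.coe_add, Measure.coe_nnreal_smul_apply, Pi.add_apply, measure_univ, mul_one]
    exact_mod_cast hst
  · rw [add_smul, mul_smul, mul_smul]
    gcongr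
    · exact h.le_smul
    · exact h'.le_smul
  · exact ((h.integrable_log hd).smul_measure_nnreal).add_measure
      ((h'.integrable_log hd).smul_measure_nnreal)

lemma interaction_convexCombination (hd : 1 ≤ d) (h : IsTame M μ) (h' : IsTame M' ν) (s t : ℝ≥0) :
    interaction (s • μ + t • ν) (s • μ + t • ν) =
      s ^ 2 * interaction μ μ + 2 * s * t * interaction ν μ + t ^ 2 * interaction ν ν := by
  have e : potential (s • μ + t • ν) = fun x => s * potential μ x + t * potential ν x := by
    funext x
    simp only [potential]
    rw [integral_add_measure (h.integrable_g_sub hd x).smul_measure_nnreal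
      (h'.integrable_g_sub hd x).smul_measure_nnreal, integral_smul_nnreal_measure,
      integral_smul_nnreal_measure]
    rfl
  have i1 : Integrable (fun x => s * potential μ x + t * potential ν x) μ :=
    ((h.integrable_potential hd h).const_mul _).add ((h'.integrable_potential hd h).const_mul _)
  have i2 : Integrable (fun x => s * potential μ x + t * potential ν x) ν :=
    ((h.integrable_potential hd h').const_mul _).add ((h'.integrable_potential hd h').const_mul _)
  have hcomm := h.interaction_comm hd h'
  rw [interaction, e, integral_add_measure i1.smul_measure_nnreal i2.smul_measure_nnreal,
    integral_smul_nnreal_measure, integral_smul_nnreal_measure,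
    integral_add ((h.integrable_potential hd h).const_mul _)
      ((h'.integrable_potential hd h).const_mul _),
    integral_add ((h.integrable_potential hd h').const_mul _)
      ((h'.integrable_potential hd h').const_mul _),
    integral_const_mul, integral_const_mul, integral_const_mul, integral_const_mul]
  simp only [interaction] at hcomm ⊢
  rw [NNReal.smul_def, NNReal.smul_def, smul_eq_mul, smul_eq_mul, ← hcomm]
  ring

lemma energy_eq (hd : 1 ≤ d) (h : IsTame M μ) (V : Space d → ℝ) :
    energy V μ = interaction μ μ + ∫ x, V x ∂μ := by
  rw [energy, h.interaction_eq hd h]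

lemma hasFiniteEnergy (hd : 1 ≤ d) (h : IsTame M μ) (hV : Integrable V μ) :
    HasFiniteEnergy V μ := by
  have : Nonempty (Fin d) := ⟨⟨0, hd⟩⟩
  exact ⟨fun x => h.absolutelyContinuous (measure_singleton x), h.integrable_g_prod hd h, hV⟩

lemma integral_effectivePotential (hd : 1 ≤ d) (h : IsTame M μ) (h' : IsTame M' ν)
    (hV : Integrable V ν) :
    Integrable (effectivePotential V μ) ν ∧ ∫ x, effectivePotential V μ x ∂ν =
      2 * interaction ν μ + ∫ x, V x ∂ν - (2 * interaction μ μ + ∫ y, V y ∂μ) := by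
  have := h'.isProbabilityMeasure
  have i1 := (h.integrable_potential hd h').const_mul 2
  have i2 : Integrable (fun x => 2 * potential μ x + V x) ν := i1.add hV
  refine ⟨i2.sub (integrable_const _), ?_⟩
  simp only [effectivePotential]
  rw [integral_sub i2 (integrable_const _), integral_add i1 hV, integral_const_mul,
    ← h.interaction_eq hd h]
  simp [interaction]

/-- Perturbing the equilibrium measure towards a tame measure `ν`. -/
lemma integral_effectivePotential_nonneg (hd : 1 ≤ d) (h : IsTame M μ)
    (hV : IsEquilibriumMeasure V μ) (h' : IsTame M' ν) (hVν : Integrable V ν) :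
    0 ≤ ∫ x, effectivePotential V μ x ∂ν := by
  have hVμ := hV.hasFiniteEnergy.integrable_potential
  rw [(h.integral_effectivePotential hd h' hVν).2]
  set A := 2 * interaction ν μ + ∫ x, V x ∂ν - (2 * interaction μ μ + ∫ y, V y ∂μ) with hA
  set B := interaction μ μ - 2 * interaction ν μ + interaction ν ν with hB
  have key : ∀ t : ℝ, 0 < t → t ≤ 1 → 0 ≤ A + t * B := by
    intro t ht ht1
    lift t to ℝ≥0 using ht.le
    have ht1' : t ≤ 1 := by exact_mod_cast ht1
    have hst : (1 - t) + t = 1 := tsub_add_cancel_of_le ht1'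
    have hc := h.convexCombination h' hst
    have hVc : Integrable V ((1 - t) • μ + t • ν) :=
      hVμ.smul_measure_nnreal.add_measure hVν.smul_measure_nnreal
    have hle := hV.energy_le _ hc.isProbabilityMeasure (hc.hasFiniteEnergy hd hVc)
    rw [h.energy_eq hd, hc.energy_eq hd, h.interaction_convexCombination hd h' _ _,
      integral_add_measure hVμ.smul_measure_nnreal hVν.smul_measure_nnreal,
      integral_smul_nnreal_measure, integral_smul_nnreal_measure, NNReal.smul_def,
      NNReal.smul_def, smul_eq_mul, smul_eq_mul, NNReal.coe_sub ht1', NNReal.coe_one] at hle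
    have : 0 ≤ (t : ℝ) * (A + t * B) := by rw [hA, hB]; linarith
    exact nonneg_of_mul_nonneg_right this ht
  have hlim : Tendsto (fun t : ℝ => A + t * B) (𝓝[>] 0) (𝓝 A) := by
    have : Tendsto (fun t : ℝ => A + t * B) (𝓝 0) (𝓝 (A + 0 * B)) :=
      Continuous.tendsto (by fun_prop) 0
    simpa using this.mono_left nhdsWithin_le_nhds
  refine ge_of_tendsto hlim ?_
  filter_upwards [Ioc_mem_nhdsGT (zero_lt_one (α := ℝ))] with t ht
  exact key t ht.1 ht.2

/-- Normalized Lebesgue measure on a bounded set. -/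
lemma cond_volume {S : Set (Space d)} (hS : volume S ≠ 0) {R : ℝ}
    (hR : S ⊆ Metric.closedBall 0 R) :
    IsTame (volume S)⁻¹.toNNReal (ProbabilityTheory.cond volume S) := by
  have hfin : volume S ≠ ⊤ :=
    ((measure_mono hR).trans_lt Metric.isBounded_closedBall.measure_lt_top).ne
  have hp := ProbabilityTheory.cond_isProbabilityMeasure_of_finite (μ := volume) hS hfin
  refine ⟨hp, ?_, fun _ => ?_⟩
  · rw [ProbabilityTheory.cond]
    intro A
    rw [Measure.smul_apply, Measure.smul_apply, ENNReal.smul_def, smul_eq_mul, smul_eq_mul,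
      ENNReal.coe_toNNReal (ENNReal.inv_ne_top.mpr hS)]
    gcongr
    exact Measure.restrict_le_self
  · refine Integrable.smul_measure ?_ (ENNReal.inv_ne_top.mpr hS)
    have : IntegrableOn (fun x : Space d => Real.log (1 + ‖x‖)) (Metric.closedBall 0 R) :=
      ContinuousOn.integrableOn_compact (isCompact_closedBall _ _)
        (Continuous.continuousOn (Continuous.log (by fun_prop) fun x => by positivity))
    exact this.mono_set hR

/-- First Euler–Lagrange condition: the effective potential is nonnegative almost everywhere. -/
lemma effectivePotential_nonneg (hd : 1 ≤ d) (h : IsTame M μ) (hc : Continuous V)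
    (hV : IsEquilibriumMeasure V μ) : ∀ᵐ x, 0 ≤ effectivePotential V μ x := by
  have := h.isProbabilityMeasure
  have hm := measurable_effectivePotential hc μ
  by_contra hcon
  have hne : volume {x | effectivePotential V μ x < 0} ≠ 0 := by
    intro h0
    apply hcon
    rw [ae_iff]
    simpa only [not_le] using h0
  obtain ⟨n, hn⟩ : ∃ n : ℕ,
      volume ({x | effectivePotential V μ x < 0} ∩ Metric.closedBall 0 n) ≠ 0 := by
    by_contra! hall
    apply hne
    have : {x | effectivePotential V μ x < 0} =
        ⋃ n : ℕ, {x | effectivePotential V μ x < 0} ∩ Metric.closedBall 0 n := by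
      rw [← Set.inter_iUnion, Metric.iUnion_closedBall_nat, Set.inter_univ]
    rw [this]
    exact measure_iUnion_null hall
  set S := {x | effectivePotential V μ x < 0} ∩ Metric.closedBall 0 (n : ℝ) with hS
  have hSm : MeasurableSet S :=
    (measurableSet_lt hm measurable_const).inter Metric.isClosed_closedBall.measurableSet
  have ht : IsTame _ (ProbabilityTheory.cond volume S) := cond_volume hn Set.inter_subset_right
  have hVt : Integrable V (ProbabilityTheory.cond volume S) := by
    refine Integrable.smul_measure ?_ (ENNReal.inv_ne_top.mpr hn)
    have : IntegrableOn V (Metric.closedBall 0 n) :=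
      ContinuousOn.integrableOn_compact (isCompact_closedBall _ _) hc.continuousOn
    exact this.mono_set Set.inter_subset_right
  have h0 := h.integral_effectivePotential_nonneg hd hV ht hVt
  have hi := (h.integral_effectivePotential hd ht hVt).1
  have hneg : ∀ᵐ x ∂(ProbabilityTheory.cond volume S), effectivePotential V μ x < 0 :=
    (ProbabilityTheory.ae_cond_mem hSm).mono fun x hx => hx.1
  have hz : (fun x => -effectivePotential V μ x) =ᵐ[ProbabilityTheory.cond volume S] 0 := by
    refine (integral_eq_zero_iff_of_nonneg_ae (f := fun x => -effectivePotential V μ x)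
      (hneg.mono fun x hx => by simpa using hx.le) hi.neg).mp ?_
    have h1 : 0 ≤ ∫ x, -effectivePotential V μ x ∂(ProbabilityTheory.cond volume S) :=
      integral_nonneg_of_ae (hneg.mono fun x hx => by simpa using hx.le)
    have h2 : ∫ x, -effectivePotential V μ x ∂(ProbabilityTheory.cond volume S) ≤ 0 := by
      rw [integral_neg]; linarith
    exact le_antisymm h2 h1
  have := ht.isProbabilityMeasure
  obtain ⟨x, hx1, hx2⟩ := (hneg.and hz).exists
  simp only [Pi.zero_apply, neg_eq_zero] at hx2
  exact hx1.ne hx2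

/-- Second Euler–Lagrange condition: the effective potential vanishes `μ`-almost everywhere. -/
lemma effectivePotential_ae_eq_zero (hd : 1 ≤ d) (h : IsTame M μ) (hc : Continuous V)
    (hV : IsEquilibriumMeasure V μ) : ∀ᵐ x ∂μ, effectivePotential V μ x = 0 := by
  have hnn : ∀ᵐ x ∂μ, 0 ≤ effectivePotential V μ x :=
    h.absolutelyContinuous.ae_le (h.effectivePotential_nonneg hd hc hV)
  have hi := h.integral_effectivePotential hd h hV.hasFiniteEnergy.integrable_potential
  exact (integral_eq_zero_iff_of_nonneg_ae hnn hi.1).mp (by rw [hi.2]; ring)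

/-- The growth assumption makes the one-particle weights of the effective potential integrable. -/
lemma exists_integrable_exp_effectivePotential (hd : 1 ≤ d) (h : IsTame M μ) (hc : Continuous V)
    (hV : IsEquilibriumMeasure V μ) (hβ : 0 < β) (hA : AssumptionA3 V β) :
    ∃ θ : ℝ, 0 < θ ∧ Integrable fun x => Real.exp (-θ * effectivePotential V μ x) := by
  have := h.isProbabilityMeasure
  obtain ⟨N, hN, hN1⟩ := (hA.and (eventually_ge_atTop 1)).exists
  have hN0 : (0 : ℝ) < N := by exact_mod_cast hN1
  have hm := measurable_effectivePotential hc μ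
  set c := 2 * ∫ p : Space d × Space d, g d (p.1 - p.2) ∂(μ.prod μ) + ∫ y, V y ∂μ
  set L := ∫ y : Space d, logGrowth y ∂μ
  refine ⟨β / 2 * N, by positivity, ?_⟩
  have hmeas : AEStronglyMeasurable
      (fun x => Real.exp (-(β / 2 * N) * effectivePotential V μ x)) volume :=
    (Real.measurable_exp.comp (hm.const_mul _)).aestronglyMeasurable
  have hind : Integrable (Set.indicator (Metric.closedBall (0 : Space d) 1) fun _ => (1 : ℝ)) :=
    (integrable_indicator_iff Metric.isClosed_closedBall.measurableSet).mpr
      (integrableOn_const (isCompact_closedBall _ _).measure_lt_top.ne)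
  refine Integrable.mono' (hind.add (hN.const_mul
    (Real.exp (β / 2 * N * (2 * Real.log 2 + 2 * L + c))))) hmeas ?_
  filter_upwards [h.effectivePotential_nonneg hd hc hV] with x hx
  rw [Real.norm_of_nonneg (Real.exp_pos _).le]
  simp only [Pi.add_apply]
  have hpot := h.neg_potential_le hd x
  have hb : 0 < β / 2 * N := by positivity
  by_cases hxb : ‖x‖ ≤ 1
  · rw [Set.indicator_of_mem (by simpa using hxb)]
    have h1 : Real.exp (-(β / 2 * N) * effectivePotential V μ x) ≤ 1 := by
      rw [Real.exp_le_one_iff]; nlinarith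
    have h2 : 0 ≤ Real.exp (β / 2 * N * (2 * Real.log 2 + 2 * L + c)) *
        (if d ≤ 2 then Real.exp (-β * N * (V x / 2 - Real.log ‖x‖))
          else Real.exp (-(β / 2) * N * V x)) := by
      split_ifs <;> positivity
    linarith
  · have hx1 : 1 < ‖x‖ := not_le.mp hxb
    rw [Set.indicator_of_notMem (by simpa using hxb), zero_add]
    have hζ : -effectivePotential V μ x ≤ 2 * (logGrowth x + L) - V x + c := by
      rw [effectivePotential]; linarith
    have hlog : logGrowth x ≤ Real.log 2 + if d ≤ 2 then Real.log ‖x‖ else 0 := by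
      unfold logGrowth
      split_ifs
      · rw [← Real.log_mul (by norm_num) (by linarith)]
        exact Real.log_le_log (by linarith) (by linarith)
      · have := Real.log_nonneg (one_le_two (α := ℝ)); linarith
    have hfin : -(β / 2 * N) * effectivePotential V μ x ≤
        β / 2 * N * (2 * Real.log 2 + 2 * L + c) +
          β / 2 * N * (2 * (if d ≤ 2 then Real.log ‖x‖ else 0) - V x) := by
      have := mul_le_mul_of_nonneg_left (hζ.trans
        (by linarith : _ ≤ 2 * (Real.log 2 + (if d ≤ 2 then Real.log ‖x‖ else 0) + L) - V x + c))
        hb.le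
      linarith
    refine (Real.exp_le_exp.mpr hfin).trans_eq ?_
    rw [Real.exp_add]
    congr 1
    split_ifs <;> congr 1 <;> ring

end IsTame

/-! ### Penalizing the zero set of the effective potential -/

/-- A set `B` of finite Lebesgue measure, null for `μ`, can be made negligible for the one-particle
weight `exp(-h)` at no cost in `∫ h dμ`. -/
lemma exists_penalty (μ : Measure (Space d)) [IsFiniteMeasure μ] {B : Set (Space d)}
    (hB : MeasurableSet B) (hBfin : volume B ≠ ⊤) (hμB : μ B = 0) {A : ℝ} (hA : 0 < A) :
    ∃ (h : Space d → ℝ) (K : Set (Space d)), Continuous h ∧ HasCompactSupport h ∧ (∀ x, 0 ≤ h x) ∧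
      ∫ x, h x ∂μ ≤ 1 ∧ MeasurableSet K ∧ K ⊆ B ∧ volume.real (B \ K) ≤ 1 ∧ ∀ x ∈ K, h x = A := by
  obtain ⟨K, hKB, hK, hKd⟩ := hB.exists_isCompact_sdiff_lt hBfin (ε := 1) one_ne_zero
  have hμK : μ K = 0 := measure_mono_null hKB hμB
  obtain ⟨U, hKU, hU, hμU⟩ := K.exists_isOpen_lt_of_lt (μ := μ) (ENNReal.ofReal A⁻¹)
    (by rw [hμK]; simpa using hA)
  obtain ⟨f, hf1, hf0, hfs, hf⟩ := exists_continuous_one_zero_of_isCompact hK hU.isClosed_compl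
    (Set.disjoint_compl_right_iff_subset.mpr hKU)
  refine ⟨fun x => A * f x, K, by fun_prop, hfs.mul_left, fun x => mul_nonneg hA.le (hf x).1, ?_,
    hK.measurableSet, hKB, ?_, fun x hx => ?_⟩
  · rw [integral_const_mul]
    have hle : ∫ x, f x ∂μ ≤ ∫ x, U.indicator (fun _ => (1 : ℝ)) x ∂μ := by
      refine integral_mono (f.continuous.integrable_of_hasCompactSupport hfs)
        ((integrable_const _).indicator hU.measurableSet) fun x => ?_
      by_cases hx : x ∈ U
      · rw [Set.indicator_of_mem hx]; exact (hf x).2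
      · rw [Set.indicator_of_notMem hx, hf0 hx]; rfl
    rw [integral_indicator hU.measurableSet, setIntegral_const, smul_eq_mul, mul_one] at hle
    have hr : μ.real U ≤ A⁻¹ := ENNReal.toReal_le_of_le_ofReal (by positivity) hμU.le
    calc A * ∫ x, f x ∂μ ≤ A * A⁻¹ := mul_le_mul_of_nonneg_left (hle.trans hr) hA.le
      _ = 1 := mul_inv_cancel₀ hA.ne'
  · exact ENNReal.toReal_le_of_le_ofReal zero_le_one (by simpa using hKd.le)
  · simp [hf1 hx]

/-- If `μ` lives on a set `S` of finite Lebesgue measure on which the nonnegative function `ζ`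
vanishes, then the one-particle weights `exp(-θ ζ)`, suitably penalized outside of `S`, have mass
at most `|S| + 3` for `θ` large, however large the zero set of `ζ` is. -/
lemma exists_penalty_integral_exp_le (μ : Measure (Space d)) [IsFiniteMeasure μ]
    {S : Set (Space d)} (hS : MeasurableSet S) (hSfin : volume S ≠ ⊤) (hμS : μ Sᶜ = 0)
    {ζ : Space d → ℝ} (hζm : Measurable ζ) (hζ : ∀ᵐ x, 0 ≤ ζ x) {θ₀ : ℝ} (hθ₀ : 0 < θ₀)
    (hint : Integrable fun x => Real.exp (-θ₀ * ζ x)) :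
    ∃ h : Space d → ℝ, Continuous h ∧ HasCompactSupport h ∧ (∀ x, 0 ≤ h x) ∧
      ∫ x, h x ∂μ ≤ 1 ∧ ∀ᶠ θ : ℝ in atTop, Integrable (fun x => Real.exp (-θ * ζ x - h x)) ∧
        ∫ x, Real.exp (-θ * ζ x - h x) ≤ volume.real S + 3 := by
  set Z : Set (Space d) := {x | ζ x ≤ 0} with hZ
  have hZm : MeasurableSet Z := measurableSet_le hζm measurable_const
  have hZfin : volume Z ≠ ⊤ := by
    refine ((measure_mono fun x hx => ?_).trans_lt (hint.measure_norm_ge_lt_top one_pos)).ne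
    have hx' : ζ x ≤ 0 := hx
    simp only [Set.mem_ofPred_eq, Real.norm_of_nonneg (Real.exp_pos _).le, Real.one_le_exp_iff]
    nlinarith
  obtain ⟨A, hA, hAZ⟩ : ∃ A : ℝ, 0 < A ∧ Real.exp (-A) * volume.real Z ≤ 1 := by
    refine ⟨volume.real Z + 1, by positivity, ?_⟩
    rw [Real.exp_neg, inv_mul_le_one₀ (Real.exp_pos _)]
    linarith [Real.add_one_le_exp (volume.real Z + 1)]
  obtain ⟨h, K, hc, hs, h0, hμh, hK, hKB, hKd, hKA⟩ := exists_penalty μ (hZm.diff hS)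
    ((measure_mono Set.sdiff_subset).trans_lt hZfin.lt_top).ne
    (measure_mono_null (fun x hx => hx.2) hμS) hA
  refine ⟨h, hc, hs, h0, hμh, ?_⟩
  have hmeas : ∀ θ : ℝ, AEStronglyMeasurable (fun x => Real.exp (-θ * ζ x - h x)) volume :=
    fun θ => (Real.measurable_exp.comp ((hζm.const_mul _).sub hc.measurable)).aestronglyMeasurable
  have hdom : ∀ᶠ θ : ℝ in atTop, ∀ᵐ x, ‖Real.exp (-θ * ζ x - h x)‖ ≤ Real.exp (-θ₀ * ζ x) := by
    filter_upwards [eventually_ge_atTop θ₀] with θ hθ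
    filter_upwards [hζ] with x hx
    rw [Real.norm_of_nonneg (Real.exp_pos _).le, Real.exp_le_exp]
    nlinarith [h0 x]
  have hlim : Tendsto (fun θ : ℝ => ∫ x, Real.exp (-θ * ζ x - h x)) atTop
      (𝓝 (∫ x, Z.indicator (fun x => Real.exp (-h x)) x)) := by
    refine tendsto_integral_filter_of_dominated_convergence _
      (Eventually.of_forall hmeas) hdom hint ?_
    filter_upwards [hζ] with x hx
    rcases hx.eq_or_lt with h1 | h1
    · rw [Set.indicator_of_mem (show x ∈ Z from h1.symm.le)]
      simp [← h1]
    · rw [Set.indicator_of_notMem (show x ∉ Z from not_le.mpr h1)]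
      refine Real.tendsto_exp_atBot.comp ?_
      refine tendsto_atBot_add_const_right _ (-h x) ?_
      exact (tendsto_neg_atTop_atBot).atBot_mul_const h1
  have hone : ∀ {W : Set (Space d)}, MeasurableSet W → volume W ≠ ⊤ →
      Integrable (W.indicator fun _ => (1 : ℝ)) volume ∧
        ∫ x, W.indicator (fun _ => (1 : ℝ)) x = volume.real W := fun hW hfin =>
    ⟨(integrable_indicator_iff hW).mpr (integrableOn_const hfin), by
      rw [integral_indicator hW, setIntegral_const, smul_eq_mul, mul_one]⟩
  have hBK := hone ((hZm.diff hS).diff hK)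
    ((measure_mono (Set.sdiff_subset.trans Set.sdiff_subset)).trans_lt hZfin.lt_top).ne
  have h1S := hone hS hSfin
  have h1Z := hone hZm hZfin
  have hle : ∫ x, Z.indicator (fun x => Real.exp (-h x)) x ≤ volume.real S + 2 := by
    have hs1 : Integrable (fun x => S.indicator (fun _ => (1 : ℝ)) x +
      ((Z \ S) \ K).indicator (fun _ => (1 : ℝ)) x) := h1S.1.add hBK.1
    have hs2 := h1Z.1.const_mul (Real.exp (-A))
    calc ∫ x, Z.indicator (fun x => Real.exp (-h x)) x
        ≤ ∫ x, (S.indicator (fun _ => (1 : ℝ)) x + ((Z \ S) \ K).indicator (fun _ => (1 : ℝ)) x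
            + Real.exp (-A) * Z.indicator (fun _ => (1 : ℝ)) x) := by
          refine integral_mono_of_nonneg (Eventually.of_forall fun x =>
            Set.indicator_nonneg (fun _ _ => (Real.exp_pos _).le) _) (hs1.add hs2)
            (Eventually.of_forall fun x => ?_)
          have hexp : Real.exp (-h x) ≤ 1 := Real.exp_le_one_iff.mpr (by linarith [h0 x])
          have hA0 := Real.exp_pos (-A)
          have n1 : 0 ≤ S.indicator (fun _ => (1 : ℝ)) x :=
            Set.indicator_nonneg (fun _ _ => zero_le_one) _
          have n2 : 0 ≤ ((Z \ S) \ K).indicator (fun _ => (1 : ℝ)) x :=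
            Set.indicator_nonneg (fun _ _ => zero_le_one) _
          simp only
          by_cases hxZ : x ∈ Z
          · rw [Set.indicator_of_mem hxZ, Set.indicator_of_mem hxZ]
            by_cases hxS : x ∈ S
            · rw [Set.indicator_of_mem hxS]; linarith
            · by_cases hxK : x ∈ K
              · rw [hKA x hxK]; linarith
              · rw [Set.indicator_of_mem (show x ∈ (Z \ S) \ K from ⟨⟨hxZ, hxS⟩, hxK⟩)]; linarith
          · rw [Set.indicator_of_notMem hxZ, Set.indicator_of_notMem hxZ]; linarith
      _ = volume.real S + volume.real ((Z \ S) \ K) + Real.exp (-A) * volume.real Z := by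
          rw [integral_add hs1 hs2, integral_add h1S.1 hBK.1, integral_const_mul, h1S.2, hBK.2,
            h1Z.2]
      _ ≤ _ := by linarith
  filter_upwards [hdom, hlim.eventually (gt_mem_nhds (show _ < volume.real S + 3 by linarith))]
    with θ h1 h2
  exact ⟨hint.mono' (hmeas θ) h1, h2.le⟩

/-! ### Upper bound on the partition function -/

/-- The exponent of the temperature scaling `N^{min(2/d-1,0)}`. -/
def tempExponent (d : ℕ) : ℝ := min (2 / (d : ℝ) - 1) 0

/-- The asymptotic expansion of `log Z` up to `O(N)`. -/
def leadingTerm (V : Space d → ℝ) (μ : Measure (Space d)) (β : ℝ) (N : ℕ) : ℝ :=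
  -(β / 2) * (N : ℝ) ^ min 2 (2 / (d : ℝ) + 1) * energy V μ
    + (if d ≤ 2 then β / (2 * (d : ℝ)) * N * Real.log N else 0)

lemma tempExponent_of_le_two (hd : 1 ≤ d) (h : d ≤ 2) : tempExponent d = 0 := by
  have h1 : (1 : ℝ) ≤ d := by exact_mod_cast hd
  have h2 : (d : ℝ) ≤ 2 := by exact_mod_cast h
  have : 1 ≤ 2 / (d : ℝ) := by rw [le_div_iff₀ (by positivity)]; linarith
  rw [tempExponent, min_eq_right]; linarith

lemma tempExponent_of_three_le (h : ¬ d ≤ 2) : tempExponent d = 2 / (d : ℝ) - 1 := by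
  have h1 : (3 : ℝ) ≤ d := by exact_mod_cast Nat.succ_le_of_lt (not_le.mp h)
  have : 2 / (d : ℝ) ≤ 1 := by rw [div_le_iff₀ (by positivity)]; linarith
  rw [tempExponent, min_eq_left]; linarith

lemma neg_one_lt_tempExponent (hd : 1 ≤ d) : -1 < tempExponent d := by
  have h1 : (1 : ℝ) ≤ d := by exact_mod_cast hd
  have : 0 < 2 / (d : ℝ) := by positivity
  rw [tempExponent, lt_min_iff]; constructor <;> linarith

lemma rpow_tempExponent_mul_sq {N : ℕ} (hN : 1 ≤ N) :
    (N : ℝ) ^ tempExponent d * (N : ℝ) ^ 2 = (N : ℝ) ^ min 2 (2 / (d : ℝ) + 1) := by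
  have hN0 : (0 : ℝ) < N := by exact_mod_cast hN
  rw [← Real.rpow_natCast, ← Real.rpow_add hN0, tempExponent, min_add, min_comm]
  congr 2 <;> push_cast <;> ring

/-- With the truncation scale `T = N^{2/d}` the tail of the interaction contributes at order
`N`. -/
lemma rpow_tempExponent_mul_tail (hd : 1 ≤ d) {N : ℕ} (hN : 1 ≤ N) :
    (N : ℝ) ^ tempExponent d * (N : ℝ) ^ 2 *
      ((N : ℝ) ^ (2 / (d : ℝ))) ^ (-min ((d : ℝ) / 2) 1) = N := by
  have hN0 : (0 : ℝ) < N := by exact_mod_cast hN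
  have hd0 : (0 : ℝ) < d := by exact_mod_cast hd
  have e : tempExponent d + (2 : ℕ) + 2 / (d : ℝ) * (-min ((d : ℝ) / 2) 1) = 1 := by
    rw [mul_neg, mul_min_of_nonneg _ _ (by positivity), tempExponent, min_add]
    have : 2 / (d : ℝ) * ((d : ℝ) / 2) = 1 := by field_simp
    rw [this, mul_one, min_comm 1, ← sub_eq_add_neg,
      show (2 / (d : ℝ) - 1 + (2 : ℕ)) = 2 / (d : ℝ) + 1 by push_cast; ring,
      show (0 : ℝ) + (2 : ℕ) = 1 + 1 by norm_num, ← min_add]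
    ring
  rw [← Real.rpow_natCast, ← Real.rpow_mul hN0.le, ← Real.rpow_add hN0, ← Real.rpow_add hN0, e,
    Real.rpow_one]

/-- With the truncation scale `T = N^{2/d}` the self-interactions contribute the `N log N` term of
the logarithmic cases and otherwise a term of order `N`. -/
lemma exists_selfEnergy_eq (hd : 1 ≤ d) : ∃ κ : ℝ, ∀ N : ℕ, 1 ≤ N →
    (N : ℝ) ^ tempExponent d * (N * selfEnergy d ((N : ℝ) ^ (2 / (d : ℝ)))) =
      (if d ≤ 2 then (N : ℝ) * Real.log N / d else 0) + κ * N := by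
  have hd0 : (0 : ℝ) < d := by exact_mod_cast hd
  by_cases h : d ≤ 2
  · refine ⟨selfEnergy d 1, fun N hN => ?_⟩
    have hN0 : (0 : ℝ) < N := by exact_mod_cast hN
    rw [tempExponent_of_le_two hd h, Real.rpow_zero, one_mul, selfEnergy, selfEnergy, if_pos h,
      if_pos h, if_pos h, Real.log_rpow hN0, Real.log_one]
    field_simp
    ring
  · refine ⟨1 / (((d : ℝ) / 2 - 1) * Real.Gamma ((d : ℝ) / 2 - 1)), fun N hN => ?_⟩
    have hN0 : (0 : ℝ) < N := by exact_mod_cast hN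
    rw [tempExponent_of_three_le h, selfEnergy, if_neg h, if_neg h, ← Real.rpow_mul hN0.le,
      show 2 / (d : ℝ) * ((d : ℝ) / 2 - 1) = -(2 / (d : ℝ) - 1) by field_simp; ring,
      Real.rpow_neg hN0.le]
    have := Real.rpow_pos_of_pos hN0 (2 / (d : ℝ) - 1)
    field_simp
    ring

lemma ae_injective (hd : 1 ≤ d) (N : ℕ) :
    ∀ᵐ X : Fin N → Space d, ∀ i j, i ≠ j → X i ≠ X j := by
  simp only [ae_all_iff, eventually_imp_distrib_left]
  intro i j hij
  let W : Submodule ℝ (Fin N → Space d) :=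
    LinearMap.ker (LinearMap.proj (R := ℝ) (φ := fun _ : Fin N => Space d) i - LinearMap.proj j)
  have hW : W ≠ ⊤ := by
    intro htop
    let v : Space d := EuclideanSpace.single ⟨0, hd⟩ 1
    have hv : v ≠ 0 := by
      intro h0
      have : ‖v‖ = 1 := by simp [v]
      rw [h0, norm_zero] at this
      exact zero_ne_one this
    have hm : Pi.single i v ∈ W := by rw [htop]; trivial
    rw [LinearMap.mem_ker] at hm
    simp only [LinearMap.sub_apply, LinearMap.proj_apply, Pi.single_eq_same,
      Pi.single_eq_of_ne hij.symm, sub_zero] at hm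
    exact hv hm
  rw [ae_iff]
  refine measure_mono_null (fun X hX => ?_)
    (Measure.addHaar_submodule (volume : Measure (Fin N → Space d)) W hW)
  have hX' : X i = X j := not_not.mp hX
  exact LinearMap.mem_ker.mpr (by simp [hX'])

lemma gibbsWeight_pos (V : Space d → ℝ) (β : ℝ) {N : ℕ} (X : Fin N → Space d) :
    0 < gibbsWeight V β X := Real.exp_pos _

lemma measurable_gibbsWeight (hV : Continuous V) (β : ℝ) (N : ℕ) :
    Measurable fun X : Fin N → Space d => gibbsWeight V β X := by
  unfold gibbsWeight hamiltonian
  refine Real.measurable_exp.comp (Measurable.const_mul ?_ _)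
  refine (Finset.measurable_sum _ fun p _ => ?_).add (Finset.measurable_sum _ fun i _ => ?_)
  · exact measurable_g.comp ((measurable_pi_apply _).sub (measurable_pi_apply _))
  · exact (hV.measurable.comp (measurable_pi_apply i)).const_mul _

/-- Rewriting the energy lower bound in terms of the effective potential. -/
lemma IsTame.hamiltonian_ge (hd : 1 ≤ d) (h : IsTame M μ) (V : Space d → ℝ) {T : ℝ} (hT : 0 < T)
    {N : ℕ} {X : Fin N → Space d} (hX : ∀ i j, i ≠ j → X i ≠ X j) :
    (N : ℝ) ^ 2 * energy V μ + N * ∑ i, effectivePotential V μ (X i) - N * selfEnergy d T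
      - 2 * (N : ℝ) ^ 2 * (M * ∫ x : Space d, highPart T x) + truncatedEnergy T μ X
    ≤ hamiltonian V X := by
  have h1 := h.sum_g_ge hd hT hX
  have h2 : ∑ i, effectivePotential V μ (X i) = 2 * ∑ i, potential μ (X i) + ∑ i, V (X i)
      - N * (2 * ∫ p : Space d × Space d, g d (p.1 - p.2) ∂(μ.prod μ) + ∫ y, V y ∂μ) := by
    simp only [effectivePotential, Finset.sum_sub_distrib, Finset.sum_add_distrib,
      ← Finset.mul_sum, Finset.sum_const, Finset.card_univ, Fintype.card_fin, nsmul_eq_mul]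
    ring
  rw [hamiltonian, h2, ← Finset.mul_sum, energy]
  linarith

/-- Upper bound on the partition function. -/
lemma IsTame.exists_partitionFunction_le (hd : 1 ≤ d) (hβ : 0 < β) (h : IsTame M μ)
    {S : Set (Space d)} (hS : MeasurableSet S) (hSfin : volume S ≠ ⊤) (hμS : μ Sᶜ = 0) :
    ∃ C : ℝ, ∀ V : Space d → ℝ, Continuous V → IsEquilibriumMeasure V μ → AssumptionA3 V β →
      ∀ᶠ N : ℕ in atTop, Integrable (fun X : Fin N → Space d => gibbsWeight V β X) ∧
        partitionFunction V β N ≤ Real.exp (leadingTerm V μ β N + C * N) := by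
  have := h.isProbabilityMeasure
  obtain ⟨κ, hκ⟩ := exists_selfEnergy_eq hd
  obtain ⟨C₁, hC₁0, hC₁⟩ := exists_integral_highPart hd
  have hd0 : (0 : ℝ) < d := by exact_mod_cast hd
  refine ⟨β / 2 * κ + β * M * C₁ + 4 + Real.log (volume.real S + 3),
    fun V hV hμV hA => ?_⟩
  obtain ⟨θ₀, hθ₀, hint⟩ := h.exists_integrable_exp_effectivePotential hd hV hμV hβ hA
  obtain ⟨f, hf, hfs, hf0, hfμ, hfθ⟩ := exists_penalty_integral_exp_le μ hS hSfin hμS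
    (measurable_effectivePotential hV μ) (h.effectivePotential_nonneg hd hV hμV) hθ₀ hint
  obtain ⟨K, T₀, hT₀, hK⟩ := h.exists_truncatedEnergy_ge hd hf hfs hf0 one_pos
  have hp := neg_one_lt_tempExponent hd
  set p := tempExponent d with hpdef
  have hNtop := tendsto_natCast_atTop_atTop (R := ℝ)
  have e1 : Tendsto (fun N : ℕ => β / 2 * ((N : ℝ) ^ p * N)) atTop atTop := by
    refine Tendsto.const_mul_atTop (by positivity) ?_
    have : Tendsto (fun N : ℕ => (N : ℝ) ^ (p + 1)) atTop atTop :=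
      (tendsto_rpow_atTop (by linarith)).comp hNtop
    refine this.congr' ?_
    filter_upwards [eventually_ge_atTop 1] with N hN
    rw [Real.rpow_add (by exact_mod_cast hN), Real.rpow_one]
  have e2 : ∀ᶠ N : ℕ in atTop, T₀ ≤ (N : ℝ) ^ (2 / (d : ℝ)) :=
    ((tendsto_rpow_atTop (by positivity)).comp hNtop).eventually_ge_atTop T₀
  have e3 : ∀ᶠ N : ℕ in atTop, K * (N : ℝ) ^ (-p) / (2 * β) ≤ N := by
    have hlim : Tendsto (fun N : ℕ => K / (2 * β) * (N : ℝ) ^ (-(p + 1))) atTop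
        (𝓝 (K / (2 * β) * 0)) :=
      (((tendsto_rpow_neg_atTop (by linarith : 0 < p + 1)).comp hNtop).const_mul _)
    rw [mul_zero] at hlim
    filter_upwards [hlim.eventually (gt_mem_nhds one_pos), eventually_ge_atTop 1] with N h1 hN
    have hN0 : (0 : ℝ) < N := by exact_mod_cast hN
    have : K * (N : ℝ) ^ (-p) / (2 * β) = K / (2 * β) * (N : ℝ) ^ (-(p + 1)) * N := by
      rw [neg_add, Real.rpow_add hN0, Real.rpow_neg_one]
      field_simp
    rw [this]
    nlinarith
  filter_upwards [e1.eventually hfθ, e2, e3, eventually_ge_atTop 1] with N hθN hTN hKN hN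
  have hN0 : (0 : ℝ) < N := by exact_mod_cast hN
  have hNp : 0 < (N : ℝ) ^ p := Real.rpow_pos_of_pos hN0 p
  set T := (N : ℝ) ^ (2 / (d : ℝ)) with hT
  have hT0 : 0 < T := hT₀.trans_le hTN
  set θ := β / 2 * ((N : ℝ) ^ p * N) with hθ
  set w : Space d → ℝ := fun x => Real.exp (-θ * effectivePotential V μ x - f x) with hw
  set R := leadingTerm V μ β N + (β / 2 * κ + β * M * C₁ + 4) * N with hR
  have hbound : ∀ᵐ X : Fin N → Space d, gibbsWeight V β X ≤ Real.exp R * ∏ i, w (X i) := by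
    filter_upwards [ae_injective hd N] with X hX
    rw [gibbsWeight, hw, ← Real.exp_sum, ← Real.exp_add, Real.exp_le_exp]
    have h1 := h.hamiltonian_ge hd V hT0 hX
    have h2 := hK T hTN N X ((N : ℝ) ^ (-p) / β) (by positivity)
    have h3 : (N : ℝ) * ∫ x, f x ∂μ ≤ N := by nlinarith
    rw [(hC₁ T hT0).2] at h1
    have k1 := hκ N hN
    have k2 := rpow_tempExponent_mul_tail hd hN
    have k3 := rpow_tempExponent_mul_sq (d := d) hN
    rw [← hT] at k1
    rw [← hpdef, ← hT] at k2
    rw [← hpdef] at k3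
    have k4 : (N : ℝ) ^ p * (N : ℝ) ^ (-p) = 1 := by
      rw [← Real.rpow_add hN0, add_neg_cancel, Real.rpow_zero]
    -- The test strength `N^(-p) / β` is the one for which `f` enters the exponent with weight `1`.
    have h4 : ∑ i, f (X i) - 4 * N ≤ β / 2 * (N : ℝ) ^ p * truncatedEnergy T μ X := by
      have h5 := mul_le_mul_of_nonneg_left h2 (by positivity : 0 ≤ β / 2 * (N : ℝ) ^ p)
      have h6 : β / 2 * (N : ℝ) ^ p * (2 * ((N : ℝ) ^ (-p) / β) *
          (∑ i, f (X i) - N * ∫ x, f x ∂μ - 2 * 1 * N) - K * ((N : ℝ) ^ (-p) / β) ^ 2) =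
          ((N : ℝ) ^ p * (N : ℝ) ^ (-p)) * (∑ i, f (X i) - N * ∫ x, f x ∂μ - 2 * N)
          - ((N : ℝ) ^ p * (N : ℝ) ^ (-p)) * (K * (N : ℝ) ^ (-p) / (2 * β)) := by
        field_simp
      rw [h6, k4] at h5
      linarith
    have h7 := mul_le_mul_of_nonneg_left h1 (by positivity : 0 ≤ β / 2 * (N : ℝ) ^ p)
    have h8 : ∑ i, (-θ * effectivePotential V μ (X i) - f (X i)) =
        -(β / 2 * ((N : ℝ) ^ p * N)) * ∑ i, effectivePotential V μ (X i) - ∑ i, f (X i) := by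
      rw [Finset.sum_sub_distrib, ← Finset.mul_sum]
    have h9 : leadingTerm V μ β N = -(β / 2) * ((N : ℝ) ^ p * (N : ℝ) ^ 2) * energy V μ
        + β / 2 * (if d ≤ 2 then (N : ℝ) * Real.log N / d else 0) := by
      rw [leadingTerm, k3]
      congr 1
      split_ifs
      · field_simp
      · simp
    rw [h8, hR, h9]
    change -(β / 2) * (N : ℝ) ^ p * hamiltonian V X ≤ _
    linear_combination h7 + h4 + (β / 2) * k1 + β * M * C₁ * k2
  have hwi : Integrable w := hθN.1
  have hprod : Integrable (fun X : Fin N → Space d => Real.exp R * ∏ i, w (X i)) :=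
    (Integrable.fintype_prod (f := fun _ : Fin N => w) fun _ => hwi).const_mul _
  have hgi : Integrable (fun X : Fin N → Space d => gibbsWeight V β X) := by
    refine hprod.mono' (measurable_gibbsWeight hV β N).aestronglyMeasurable ?_
    filter_upwards [hbound] with X hX
    rwa [Real.norm_of_nonneg (gibbsWeight_pos V β X).le]
  refine ⟨hgi, ?_⟩
  have hw0 : 0 ≤ ∫ x, w x := integral_nonneg fun x => (Real.exp_pos _).le
  have hS3 : 0 < volume.real S + 3 := by positivity
  calc partitionFunction V β N ≤ ∫ X : Fin N → Space d, Real.exp R * ∏ i, w (X i) :=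
        integral_mono_ae hgi hprod hbound
    _ = Real.exp R * (∫ x, w x) ^ N := by
        rw [integral_const_mul, integral_fintype_prod_volume_eq_pow (ι := Fin N) w,
          Fintype.card_fin]
    _ ≤ Real.exp R * (volume.real S + 3) ^ N := by
        gcongr
        exact hθN.2
    _ = Real.exp (leadingTerm V μ β N +
          (β / 2 * κ + β * M * C₁ + 4 + Real.log (volume.real S + 3)) * N) := by
        rw [← Real.exp_log (pow_pos hS3 N), ← Real.exp_add, Real.log_pow, hR]
        congr 1; ring

/-! ### Lower bound on the partition function -/

lemma pi_mono {ι α : Type*} [Fintype ι] [MeasurableSpace α] {μ ν : ι → Measure α}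
    (h : ∀ i, μ i ≤ ν i) : Measure.pi μ ≤ Measure.pi ν := by
  refine Measure.le_iff.mpr fun s hs => ?_
  rw [Measure.pi, Measure.pi, toMeasure_apply _ _ hs, toMeasure_apply _ _ hs]
  have : OuterMeasure.pi (fun i => (μ i).toOuterMeasure) ≤
      OuterMeasure.pi fun i => (ν i).toOuterMeasure :=
    OuterMeasure.le_pi.mpr fun t _ => (OuterMeasure.pi_pi_le _ _).trans
      (Finset.prod_le_prod' fun i _ => h i (t i))
  exact this s

lemma pi_smul {ι α : Type*} [Fintype ι] [MeasurableSpace α] (c : ℝ≥0) (ν : ι → Measure α)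
    [∀ i, SigmaFinite (ν i)] :
    Measure.pi (fun i => c • ν i) = c ^ Fintype.card ι • Measure.pi ν := by
  refine Measure.pi_eq fun s _ => ?_
  rw [Measure.smul_apply, Measure.pi_pi, ENNReal.smul_def, smul_eq_mul]
  simp only [Measure.smul_apply, ENNReal.smul_def, smul_eq_mul]
  rw [Finset.prod_mul_distrib, Finset.prod_const, Finset.card_univ, ENNReal.coe_pow]

lemma pi_le_smul_volume {N : ℕ} {ν : Fin N → Measure (Space d)}
    (h : ∀ i, ν i ≤ K • (volume : Measure (Space d))) :
    Measure.pi ν ≤ K ^ N • (volume : Measure (Fin N → Space d)) := by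
  refine (pi_mono h).trans_eq ?_
  rw [pi_smul, Fintype.card_fin]
  rfl

/-- The law of two distinct coordinates of a product measure. -/
lemma pi_map_pair {N : ℕ} (ν : Fin N → Measure (Space d)) [∀ i, IsProbabilityMeasure (ν i)]
    {i j : Fin N} (hij : i ≠ j) :
    (Measure.pi ν).map (fun X => (X i, X j)) = (ν i).prod (ν j) := by
  have h1 := (ProbabilityTheory.iIndepFun_pi (μ := ν) (X := fun _ x => x)
    fun i => aemeasurable_id).indepFun hij
  have h2 := (ProbabilityTheory.indepFun_iff_map_prod_eq_prod_map_map
    (measurable_pi_apply i).aemeasurable (measurable_pi_apply j).aemeasurable).mp h1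
  rw [h2]
  congr 1
  · exact (measurePreserving_eval ν i).map_eq
  · exact (measurePreserving_eval ν j).map_eq

/-- The mean energy of independent points. -/
lemma integral_hamiltonian (hd : 1 ≤ d) {N : ℕ} (ν : Fin N → Measure (Space d))
    (hν : ∀ i, IsTame K (ν i)) (hV : ∀ i, Integrable V (ν i)) :
    Integrable (fun X => hamiltonian V X) (Measure.pi ν) ∧
      ∫ X, hamiltonian V X ∂Measure.pi ν =
        ∑ i, ∑ j, interaction (ν i) (ν j) - ∑ i, interaction (ν i) (ν i)
          + N * ∑ i, ∫ x, V x ∂ν i := by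
  have : ∀ i, IsProbabilityMeasure (ν i) := fun i => (hν i).isProbabilityMeasure
  have hm : Measurable fun p : Space d × Space d => g d (p.1 - p.2) :=
    measurable_g.comp (by fun_prop)
  have hpair : ∀ i j : Fin N, i ≠ j → Integrable (fun X : Fin N → Space d => g d (X i - X j))
      (Measure.pi ν) ∧ ∫ X, g d (X i - X j) ∂Measure.pi ν = interaction (ν i) (ν j) := by
    intro i j hij
    have hmap := pi_map_pair ν hij
    have hae : AEMeasurable (fun X : Fin N → Space d => (X i, X j)) (Measure.pi ν) :=
      ((measurable_pi_apply i).prodMk (measurable_pi_apply j)).aemeasurable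
    have hi := (hν j).integrable_g_prod hd (hν i)
    rw [(hν j).interaction_eq hd (hν i)]
    rw [← hmap] at hi ⊢
    refine ⟨(integrable_map_measure hm.aestronglyMeasurable hae).mp hi, ?_⟩
    rw [integral_map hae hm.aestronglyMeasurable]
  have i1 : ∀ p ∈ (Finset.univ : Finset (Fin N)).offDiag,
      Integrable (fun X : Fin N → Space d => g d (X p.1 - X p.2)) (Measure.pi ν) := fun p hp =>
    (hpair p.1 p.2 (Finset.mem_offDiag.mp hp).2.2).1
  have i2 : ∀ i ∈ (Finset.univ : Finset (Fin N)),
      Integrable (fun X : Fin N → Space d => (N : ℝ) * V (X i)) (Measure.pi ν) := fun i _ =>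
    (integrable_comp_eval (hV i)).const_mul _
  refine ⟨(integrable_finsetSum _ i1).add (integrable_finsetSum _ i2), ?_⟩
  simp only [hamiltonian]
  rw [integral_add (integrable_finsetSum _ i1) (integrable_finsetSum _ i2),
    integral_finsetSum _ i1, integral_finsetSum _ i2,
    ← sum_offDiag_eq fun i j => interaction (ν i) (ν j), Finset.mul_sum]
  congr 1
  · exact Finset.sum_congr rfl fun p hp => (hpair p.1 p.2 (Finset.mem_offDiag.mp hp).2.2).2
  · refine Finset.sum_congr rfl fun i _ => ?_
    rw [integral_const_mul, integral_comp_eval (hV i).1]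

/-- Jensen's inequality for the Gibbs weight under independent points. -/
lemma exp_le_integral_gibbsWeight (hd : 1 ≤ d) {N : ℕ} (ν : Fin N → Measure (Space d))
    (hν : ∀ i, IsTame K (ν i)) (hV : ∀ i, Integrable V (ν i))
    (hZ : Integrable (fun X : Fin N → Space d => gibbsWeight V β X)) :
    Integrable (fun X : Fin N → Space d => gibbsWeight V β X) (Measure.pi ν) ∧
    Real.exp (-(β / 2) * (N : ℝ) ^ tempExponent d * (∑ i, ∑ j, interaction (ν i) (ν j)
      - ∑ i, interaction (ν i) (ν i) + N * ∑ i, ∫ x, V x ∂ν i)) ≤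
      ∫ X, gibbsWeight V β X ∂Measure.pi ν := by
  have : ∀ i, IsProbabilityMeasure (ν i) := fun i => (hν i).isProbabilityMeasure
  have hZν : Integrable (fun X : Fin N → Space d => gibbsWeight V β X) (Measure.pi ν) :=
    (hZ.smul_measure_nnreal (c := K ^ N)).mono_measure
      (pi_le_smul_volume fun i => (hν i).le_smul)
  refine ⟨hZν, ?_⟩
  obtain ⟨hi, he⟩ := integral_hamiltonian hd ν hν hV
  rw [← he, ← integral_const_mul]
  exact convexOn_exp.map_integral_le Real.continuous_exp.continuousOn isClosed_univ
    (Eventually.of_forall fun _ => Set.mem_univ _) (hi.const_mul _) hZν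

lemma integral_pi_le_partitionFunction (hle : μ ≤ M • (volume : Measure (Space d)))
    [IsFiniteMeasure μ] {N : ℕ} (hZ : Integrable (fun X : Fin N → Space d => gibbsWeight V β X)) :
    ∫ X : Fin N → Space d, gibbsWeight V β X ∂Measure.pi (fun _ => μ)
      ≤ (M : ℝ) ^ N * partitionFunction V β N := by
  have := integral_mono_measure (pi_le_smul_volume (N := N) fun _ => hle)
    (Eventually.of_forall fun X => (gibbsWeight_pos V β X).le)
    (hZ.smul_measure_nnreal (c := M ^ N))
  rw [integral_smul_nnreal_measure] at this
  simpa [NNReal.smul_def, partitionFunction] using this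

/-- Lower bound on the partition function in the Coulomb case, by testing with independent
points of law `μ`. -/
lemma IsTame.exp_le_partitionFunction_of_three_le (hd : ¬ d ≤ 2) (hβ : 0 < β) (h : IsTame M μ)
    (hM : 0 < M) (hV : Integrable V μ) {N : ℕ} (hN : 1 ≤ N)
    (hZ : Integrable (fun X : Fin N → Space d => gibbsWeight V β X)) :
    Real.exp (leadingTerm V μ β N - Real.log M * N) ≤ partitionFunction V β N := by
  have := h.isProbabilityMeasure
  have hd1 : 1 ≤ d := by omega
  have hM' : (0 : ℝ) < M := hM
  have hJ := (exp_le_integral_gibbsWeight (β := β) hd1 (fun _ : Fin N => μ) (fun _ => h)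
    (fun _ => hV) hZ).2
  have hle := hJ.trans (integral_pi_le_partitionFunction h.le_smul hZ)
  have hg0 : 0 ≤ interaction μ μ := by
    refine integral_nonneg fun x => integral_nonneg fun y => ?_
    simp only [g, if_neg hd]
    positivity
  have hexp : leadingTerm V μ β N ≤ -(β / 2) * (N : ℝ) ^ tempExponent d *
      (∑ _i : Fin N, ∑ _j : Fin N, interaction μ μ - ∑ _i : Fin N, interaction μ μ
        + N * ∑ _i : Fin N, ∫ x, V x ∂μ) := by
    simp only [Finset.sum_const, Finset.card_univ, Fintype.card_fin, nsmul_eq_mul]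
    rw [leadingTerm, if_neg hd, ← rpow_tempExponent_mul_sq hN, h.energy_eq hd1, add_zero]
    have : 0 ≤ β / 2 * (N : ℝ) ^ tempExponent d * (N * interaction μ μ) := by positivity
    linarith
  have h1 := (Real.exp_le_exp.mpr hexp).trans hle
  rw [Real.exp_sub, mul_comm (Real.log M), Real.exp_nat_mul, Real.exp_log hM',
    div_le_iff₀ (by positivity)]
  linarith

/-- A partition of the mass of `μ` into `N` cells of equal mass. -/
structure IsEqualPartition (μ : Measure (Space d)) {N : ℕ} (c : Fin N → Set (Space d)) :
    Prop where
  measurableSet : ∀ i, MeasurableSet (c i)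
  disjoint : Pairwise (Function.onFun Disjoint c)
  measure_eq : ∀ i, μ (c i) = (N : ℝ≥0∞)⁻¹

namespace IsEqualPartition

variable {N : ℕ} {c : Fin N → Set (Space d)}

lemma comp_equiv (h : IsEqualPartition μ c) (σ : Equiv.Perm (Fin N)) :
    IsEqualPartition μ (fun i => c (σ i)) :=
  ⟨fun _ => h.measurableSet _, fun _ _ hij => h.disjoint (σ.injective.ne hij),
    fun _ => h.measure_eq _⟩

lemma isTame_cell (h : IsEqualPartition μ c) (hN : 1 ≤ N) (hμ : IsTame M μ) (i : Fin N) :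
    IsTame (N * M) ((N : ℝ≥0) • μ.restrict (c i)) := by
  refine ⟨⟨?_⟩, ?_, fun hd => ?_⟩
  · rw [Measure.smul_apply, Measure.restrict_apply_univ, h.measure_eq, ENNReal.smul_def,
      smul_eq_mul, ENNReal.coe_natCast]
    exact ENNReal.mul_inv_cancel (by simpa using Nat.one_le_iff_ne_zero.mp hN)
      (ENNReal.natCast_ne_top N)
  · rw [mul_smul]
    gcongr
    exact Measure.restrict_le_self.trans hμ.le_smul
  · exact (hμ.integrable_log hd).restrict.smul_measure_nnreal

lemma sum_integral (h : IsEqualPartition μ c) (hN : 1 ≤ N) [IsProbabilityMeasure μ]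
    {f : Space d → ℝ} (hf : Integrable f μ) :
    ∑ i, ∫ x, f x ∂((N : ℝ≥0) • μ.restrict (c i)) = N * ∫ x, f x ∂μ := by
  have hfull : μ (⋃ i, c i)ᶜ = 0 := by
    have hm : MeasurableSet (⋃ i, c i) := MeasurableSet.iUnion h.measurableSet
    rw [prob_compl_eq_zero_iff hm, measure_iUnion h.disjoint h.measurableSet, tsum_fintype]
    simp only [h.measure_eq, Finset.sum_const, Finset.card_univ, Fintype.card_fin, nsmul_eq_mul]
    exact ENNReal.mul_inv_cancel (by simpa using Nat.one_le_iff_ne_zero.mp hN)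
      (ENNReal.natCast_ne_top N)
  have hae : ∀ᵐ x ∂μ, x ∈ ⋃ i, c i := by
    rw [ae_iff]; exact hfull
  have h1 := integral_iUnion_fintype h.measurableSet h.disjoint (f := f) (μ := μ)
    fun i => hf.integrableOn
  rw [Measure.restrict_eq_self_of_ae_mem hae] at h1
  simp only [integral_smul_nnreal_measure, NNReal.smul_def, smul_eq_mul, NNReal.coe_natCast]
  rw [h1, Finset.mul_sum]

lemma sum_interaction (h : IsEqualPartition μ c) (hd : 1 ≤ d) (hN : 1 ≤ N) (hμ : IsTame M μ) :
    ∑ i, ∑ j, interaction ((N : ℝ≥0) • μ.restrict (c i)) ((N : ℝ≥0) • μ.restrict (c j)) =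
      (N : ℝ) ^ 2 * interaction μ μ := by
  have := hμ.isProbabilityMeasure
  have hpot : ∀ x, ∑ j, potential ((N : ℝ≥0) • μ.restrict (c j)) x = N * potential μ x := fun x =>
    h.sum_integral hN (hμ.integrable_g_sub hd x)
  have h1 : ∀ i, ∑ j, interaction ((N : ℝ≥0) • μ.restrict (c i)) ((N : ℝ≥0) • μ.restrict (c j)) =
      ∫ x, N * potential μ x ∂((N : ℝ≥0) • μ.restrict (c i)) := fun i => by
    simp only [interaction]
    rw [← integral_finsetSum _ fun j _ => (h.isTame_cell hN hμ j).integrable_potential hd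
      (h.isTame_cell hN hμ i)]
    simp_rw [hpot]
  simp_rw [h1]
  rw [h.sum_integral hN ((hμ.integrable_potential hd hμ).const_mul _), integral_const_mul]
  simp only [interaction]
  ring

/-- Points chosen independently, one in each cell, lose only the interactions inside of the
cells. -/
lemma exp_le_setIntegral (h : IsEqualPartition μ c) (hd : 1 ≤ d) (hN : 1 ≤ N) (hμ : IsTame M μ)
    (hV : Integrable V μ) (hZ : Integrable (fun X : Fin N → Space d => gibbsWeight V β X)) :
    Real.exp (-(β / 2) * (N : ℝ) ^ tempExponent d * ((N : ℝ) ^ 2 * energy V μ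
      - ∑ i, interaction ((N : ℝ≥0) • μ.restrict (c i)) ((N : ℝ≥0) • μ.restrict (c i)))) ≤
      (N : ℝ) ^ N * ∫ X in Set.univ.pi c, gibbsWeight V β X ∂Measure.pi (fun _ => μ) := by
  have := hμ.isProbabilityMeasure
  have hJ := (exp_le_integral_gibbsWeight (β := β) hd
    (fun i : Fin N => (N : ℝ≥0) • μ.restrict (c i)) (fun i => h.isTame_cell hN hμ i)
    (fun i => hV.restrict.smul_measure_nnreal) hZ).2
  rw [h.sum_interaction hd hN hμ, h.sum_integral hN hV, pi_smul, Fintype.card_fin,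
    integral_smul_nnreal_measure, ← Measure.restrict_pi_pi] at hJ
  rw [hμ.energy_eq hd]
  refine le_trans (le_of_eq ?_) (hJ.trans_eq ?_)
  · congr 1; ring
  · simp [NNReal.smul_def]

/-- Summing over the `N!` ways to distribute the points over the cells. -/
lemma exp_le_partitionFunction (h : IsEqualPartition μ c) (hd : 1 ≤ d) (hN : 1 ≤ N)
    (hμ : IsTame M μ) (hM : 0 < M) (hV : Integrable V μ)
    (hZ : Integrable (fun X : Fin N → Space d => gibbsWeight V β X)) :
    Real.exp (-(β / 2) * (N : ℝ) ^ tempExponent d * ((N : ℝ) ^ 2 * energy V μ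
      - ∑ i, interaction ((N : ℝ≥0) • μ.restrict (c i)) ((N : ℝ≥0) • μ.restrict (c i)))
      - N - Real.log M * N) ≤ partitionFunction V β N := by
  have := hμ.isProbabilityMeasure
  have hM' : (0 : ℝ) < M := hM
  have hN0 : (0 : ℝ) < N := by exact_mod_cast hN
  set E := Real.exp (-(β / 2) * (N : ℝ) ^ tempExponent d * ((N : ℝ) ^ 2 * energy V μ
      - ∑ i, interaction ((N : ℝ≥0) • μ.restrict (c i)) ((N : ℝ≥0) • μ.restrict (c i)))) with hE
  set P : Measure (Fin N → Space d) := Measure.pi fun _ => μ with hP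
  have hZP : Integrable (fun X : Fin N → Space d => gibbsWeight V β X) P :=
    (hZ.smul_measure_nnreal (c := M ^ N)).mono_measure (pi_le_smul_volume fun i => hμ.le_smul)
  have h1 : ∀ σ : Equiv.Perm (Fin N), E ≤
      (N : ℝ) ^ N * ∫ X in Set.univ.pi fun i => c (σ i), gibbsWeight V β X ∂P := fun σ => by
    have := (h.comp_equiv σ).exp_le_setIntegral (β := β) hd hN hμ hV hZ
    rwa [Equiv.sum_comp σ fun i => interaction ((N : ℝ≥0) • μ.restrict (c i))
      ((N : ℝ≥0) • μ.restrict (c i))] at this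
  have hdisj : Pairwise (Function.onFun Disjoint fun σ : Equiv.Perm (Fin N) =>
      Set.univ.pi fun i => c (σ i)) := by
    intro σ σ' hne
    obtain ⟨i, hi⟩ : ∃ i, σ i ≠ σ' i := by
      by_contra! hall
      exact hne (Equiv.ext hall)
    rw [Function.onFun, Set.disjoint_left]
    intro X hX hX'
    exact Set.disjoint_left.mp (h.disjoint hi) (hX i trivial) (hX' i trivial)
  have h2 : ∑ σ : Equiv.Perm (Fin N), ∫ X in Set.univ.pi fun i => c (σ i), gibbsWeight V β X ∂P
      ≤ ∫ X, gibbsWeight V β X ∂P := by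
    rw [← integral_iUnion_fintype (fun σ => MeasurableSet.univ_pi fun i => h.measurableSet _) hdisj
      fun σ => hZP.integrableOn]
    exact setIntegral_le_integral hZP (Eventually.of_forall fun X => (gibbsWeight_pos V β X).le)
  have h3 : (N.factorial : ℝ) * E ≤ (N : ℝ) ^ N * ((M : ℝ) ^ N * partitionFunction V β N) := by
    calc (N.factorial : ℝ) * E = ∑ _σ : Equiv.Perm (Fin N), E := by
          simp [Fintype.card_perm]
      _ ≤ ∑ σ : Equiv.Perm (Fin N),
          (N : ℝ) ^ N * ∫ X in Set.univ.pi fun i => c (σ i), gibbsWeight V β X ∂P :=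
        Finset.sum_le_sum fun σ _ => h1 σ
      _ ≤ (N : ℝ) ^ N * ∫ X, gibbsWeight V β X ∂P := by
        rw [← Finset.mul_sum]; gcongr
      _ ≤ _ := by gcongr; exact integral_pi_le_partitionFunction hμ.le_smul hZ
  have h4 : (N : ℝ) ^ N ≤ Real.exp N * N.factorial := by
    have := Real.pow_div_factorial_le_exp (N : ℝ) hN0.le N
    rwa [div_le_iff₀ (by positivity)] at this
  have hpow : (0 : ℝ) < (N : ℝ) ^ N := by positivity
  have hfac : (0 : ℝ) < N.factorial := by positivity
  have hE0 : 0 < E := Real.exp_pos _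
  have hZ0 : 0 ≤ (M : ℝ) ^ N * partitionFunction V β N :=
    mul_nonneg (by positivity) (integral_nonneg fun X => (gibbsWeight_pos V β X).le)
  rw [Real.exp_sub, Real.exp_sub, ← hE, mul_comm (Real.log M), Real.exp_nat_mul, Real.exp_log hM',
    div_div, div_le_iff₀ (by positivity)]
  have h5 : (N.factorial : ℝ) * E ≤ N.factorial *
      (Real.exp N * ((M : ℝ) ^ N * partitionFunction V β N)) := by
    refine h3.trans ?_
    calc (N : ℝ) ^ N * ((M : ℝ) ^ N * partitionFunction V β N)
        ≤ (Real.exp N * N.factorial) * ((M : ℝ) ^ N * partitionFunction V β N) := by gcongr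
      _ = _ := by ring
  have h6 := le_of_mul_le_mul_left h5 hfac
  linarith

end IsEqualPartition

/-! ### Equal partitions at quantiles -/

/-- A bounded increasing reparametrization of the line. -/
def squash (u : ℝ) : ℝ := u / (1 + |u|)

lemma abs_squash_lt (u : ℝ) : |squash u| < 1 := by
  rw [squash, abs_div, abs_of_pos (by positivity : 0 < 1 + |u|), div_lt_one (by positivity)]
  linarith

lemma measurable_squash : Measurable squash := by unfold squash; fun_prop

lemma abs_sub_le_squash (u v : ℝ) :
    |u - v| ≤ |squash u - squash v| * ((1 + |u|) * (1 + |v|)) := by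
  have hu : 0 < 1 + |u| := by positivity
  have hv : 0 < 1 + |v| := by positivity
  have e : |squash u - squash v| * ((1 + |u|) * (1 + |v|)) = |u - v + (u * |v| - v * |u|)| := by
    rw [← abs_of_pos (mul_pos hu hv), ← abs_mul, squash, squash]
    congr 1
    field_simp
    ring
  rw [e]
  rcases le_total 0 u with h1 | h1 <;> rcases le_total 0 v with h2 | h2
  · rw [abs_of_nonneg h1, abs_of_nonneg h2]; ring_nf; exact le_rfl
  · rw [abs_of_nonneg h1, abs_of_nonpos h2]
    have : 0 ≤ -(u * v) := by nlinarith
    rw [abs_of_nonneg (by linarith : 0 ≤ u - v), abs_of_nonneg (by linarith)]; linarith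
  · rw [abs_of_nonpos h1, abs_of_nonneg h2]
    have : 0 ≤ -(u * v) := by nlinarith
    rw [abs_of_nonpos (by linarith : u - v ≤ 0), abs_of_nonpos (by linarith)]; linarith
  · rw [abs_of_nonpos h1, abs_of_nonpos h2]; ring_nf; exact le_rfl

/-- Quantiles of a random variable without atoms and with values in `(-1, 1)`. -/
lemma exists_quantile {Ω : Type*} [MeasurableSpace Ω] (ν : Measure Ω) [IsFiniteMeasure ν]
    {f : Ω → ℝ} (hf : Measurable f) (hf1 : ∀ ω, |f ω| < 1) (h0 : ∀ t, ν {ω | f ω = t} = 0) :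
    ∃ q : ℝ → ℝ, Monotone q ∧ (∀ t, |q t| ≤ 1) ∧
      ∀ s t, 0 ≤ s → s ≤ t → t ≤ ν.real Set.univ →
        ν.real {ω | f ω ∈ Set.Ioc (q s) (q t)} = t - s := by
  set F : ℝ → ℝ := fun t => ν.real {ω | f ω ≤ t} with hF
  have hms : ∀ t, MeasurableSet {ω | f ω ≤ t} := fun t => measurableSet_le hf measurable_const
  have hmono : Monotone F := fun s t hst => measureReal_mono fun ω hω => le_trans hω hst
  have hcont : Continuous F := by
    have e : F = fun t => ∫ ω, {ω | f ω ≤ t}.indicator (fun _ => (1 : ℝ)) ω ∂ν := by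
      funext t
      rw [integral_indicator (hms t), setIntegral_const, smul_eq_mul, mul_one]
    rw [e, continuous_iff_continuousAt]
    intro t
    refine continuousAt_of_dominated (bound := fun _ => 1) (Eventually.of_forall fun s => ?_)
      (Eventually.of_forall fun s => Eventually.of_forall fun ω => ?_) (integrable_const _) ?_
    · exact (measurable_const.indicator (hms s)).aestronglyMeasurable
    · exact (norm_indicator_le_norm_self _ _).trans (by simp)
    · have : ∀ᵐ ω ∂ν, f ω ≠ t := by rw [ae_iff]; simpa using h0 t
      filter_upwards [this] with ω hω
      -- The indicator is locally constant in the threshold away from `f ω`.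
      refine ContinuousAt.congr_of_eventuallyEq (f := fun _ =>
        {ω | f ω ≤ t}.indicator (fun _ => (1 : ℝ)) ω) continuousAt_const ?_
      rcases lt_or_gt_of_ne hω with h | h
      · filter_upwards [lt_mem_nhds h] with s hs
        rw [Set.indicator_of_mem (show ω ∈ {ω | f ω ≤ s} from hs.le),
          Set.indicator_of_mem (show ω ∈ {ω | f ω ≤ t} from h.le)]
      · filter_upwards [gt_mem_nhds h] with s hs
        rw [Set.indicator_of_notMem (show ω ∉ {ω | f ω ≤ s} from not_le.mpr hs),
          Set.indicator_of_notMem (show ω ∉ {ω | f ω ≤ t} from not_le.mpr h)]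
  have hFl : F (-1) = 0 := by
    have : {ω | f ω ≤ -1} = ∅ := by
      ext ω
      simp only [Set.mem_ofPred_eq, Set.mem_empty_iff_false, iff_false, not_le]
      exact (abs_lt.mp (hf1 ω)).1
    simp [hF, this]
  have hFr : F 1 = ν.real Set.univ := by
    have : {ω | f ω ≤ 1} = Set.univ := by
      ext ω
      simp only [Set.mem_ofPred_eq, Set.mem_univ, iff_true]
      exact (abs_lt.mp (hf1 ω)).2.le
    simp [hF, this]
  have hex : ∀ t : ℝ, ∃ x ∈ Set.Icc (-1 : ℝ) 1, F x = max 0 (min t (ν.real Set.univ)) := by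
    intro t
    have hsub := intermediate_value_Icc (by norm_num : (-1 : ℝ) ≤ 1) hcont.continuousOn
    rw [hFl, hFr] at hsub
    exact hsub ⟨le_max_left _ _, max_le measureReal_nonneg (min_le_right _ _)⟩
  choose q₀ hq1 hq2 using hex
  have hclamp : ∀ t, 0 ≤ t → t ≤ ν.real Set.univ → max 0 (min t (ν.real Set.univ)) = t := by
    intro t ht0 ht1
    rw [min_eq_left ht1, max_eq_right ht0]
  -- Composing with the projection onto `[0, ν(Ω)]` makes the choice monotone on the whole line.
  set m := ν.real Set.univ with hm
  refine ⟨fun t => q₀ (max 0 (min t m)), ?_, fun t => abs_le.mpr (hq1 _), ?_⟩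
  · intro s t hst
    have hle : max 0 (min s m) ≤ max 0 (min t m) := by gcongr
    rcases hle.eq_or_lt with h | h
    · simp only [h]; exact le_rfl
    · by_contra hcon
      have hF1 := hmono (not_le.mp hcon).le
      simp only [hq2] at hF1
      have c : ∀ r, max 0 (min (max 0 (min r m)) m) = max 0 (min r m) := fun r =>
        hclamp _ (le_max_left _ _) (max_le measureReal_nonneg (min_le_right _ _))
      rw [c, c] at hF1
      exact absurd h (not_lt.mpr hF1)
  · intro s t hs hst ht
    have hs' : F (q₀ (max 0 (min s m))) = s := by
      rw [hclamp s hs (hst.trans ht), hq2, hclamp s hs (hst.trans ht)]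
    have ht' : F (q₀ (max 0 (min t m))) = t := by
      rw [hclamp t (hs.trans hst) ht, hq2, hclamp t (hs.trans hst) ht]
    set a := q₀ (max 0 (min s m))
    set b := q₀ (max 0 (min t m))
    change ν.real {ω | f ω ∈ Set.Ioc a b} = t - s
    rcases hst.eq_or_lt with h | h
    · have : a = b := by simp only [a, b, h]
      rw [this, h]; simp
    · have hab : a ≤ b := by
        by_contra hcon
        have := hmono (not_le.mp hcon).le
        rw [hs', ht'] at this
        exact absurd h (not_lt.mpr this)
      have e : {ω | f ω ∈ Set.Ioc a b} = {ω | f ω ≤ b} \ {ω | f ω ≤ a} := by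
        ext ω
        simp only [Set.mem_ofPred_eq, Set.mem_Ioc, Set.mem_sdiff, not_le]
        exact and_comm
      have hsub : {ω | f ω ≤ a} ⊆ {ω | f ω ≤ b} := fun ω hω => le_trans hω hab
      rw [e, measureReal_sdiff hsub (hms a)]
      change F b - F a = _
      rw [hs', ht']

lemma sum_quantile_le {q : ℝ → ℝ} (hq : ∀ t, |q t| ≤ 1) (s : ℕ → ℝ) (n : ℕ) :
    ∑ k ∈ Finset.range n, (q (s (k + 1)) - q (s k)) ≤ 2 := by
  rw [Finset.sum_range_sub fun k => q (s k)]
  have h1 := (abs_le.mp (hq (s n))).2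
  have h2 := (abs_le.mp (hq (s 0))).1
  linarith

lemma IsTame.measure_squash_eq (h : IsTame M μ) (e : Fin d) (t : ℝ) :
    μ {x | squash (x e) = t} = 0 := by
  apply h.absolutelyContinuous
  by_cases hne : ∃ y : Space d, squash (y e) = t
  · obtain ⟨y, hy⟩ := hne
    refine measure_mono_null (fun x hx => ?_) (t := WithLp.ofLp ⁻¹' {f | f e = y e}) ?_
    · have h1 := abs_sub_le_squash (x e) (y e)
      have hx' : squash (x e) = t := hx
      rw [hx', hy, sub_self, abs_zero, zero_mul] at h1
      exact sub_eq_zero.mp (abs_eq_zero.mp (le_antisymm h1 (abs_nonneg _)))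
    · have hm : MeasurableSet {f : Fin d → ℝ | f e = y e} :=
        measurableSet_eq_fun (measurable_pi_apply e) measurable_const
      rw [(PiLp.volume_preserving_ofLp (Fin d)).measure_preimage hm.nullMeasurableSet]
      exact Measure.pi_hyperplane (fun _ : Fin d => (volume : Measure ℝ)) e (y e)
  · push Not at hne
    have : {x : Space d | squash (x e) = t} = ∅ := by
      ext x; simpa using hne x
    rw [this]; exact measure_empty

lemma norm_sub_le_squash (x y : Space d) : ‖x - y‖ ≤
    (∑ e, |squash (x e) - squash (y e)|) * ((1 + ‖x‖) * (1 + ‖y‖)) := by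
  have h1 : ‖x - y‖ ≤ ∑ e, |x e - y e| := by
    have hs : (0 : ℝ) ≤ ∑ e, |x e - y e| := Finset.sum_nonneg fun _ _ => abs_nonneg _
    rw [EuclideanSpace.norm_eq, Real.sqrt_le_left hs]
    refine (Finset.sum_sq_le_sq_sum_of_nonneg (f := fun e => |x e - y e|)
      fun _ _ => abs_nonneg _).trans' (le_of_eq ?_)
    rfl
  refine h1.trans ?_
  rw [Finset.sum_mul]
  refine Finset.sum_le_sum fun e _ => (abs_sub_le_squash (x e) (y e)).trans ?_
  have hx : |x e| ≤ ‖x‖ := by simpa using PiLp.norm_apply_le x e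
  have hy : |y e| ≤ ‖y‖ := by simpa using PiLp.norm_apply_le y e
  gcongr

/-- The cells of an equal partition have, on average, diameter of order `N^{-1/d}`. The diameter
of the cell `c i` is bounded by `D i` in the metric of the coordinatewise compactification `squash`,
which the weights `1 + ‖x‖` compare with the Euclidean one. -/
structure HasSmallCells {N : ℕ} (c : Fin N → Set (Space d)) (D : Fin N → ℝ) (C : ℝ) : Prop where
  norm_sub_le : ∀ i, ∀ x ∈ c i, ∀ y ∈ c i, ‖x - y‖ ≤ D i * ((1 + ‖x‖) * (1 + ‖y‖))
  sum_le : ∑ i, D i ≤ C * (N : ℝ) ^ (1 - 1 / (d : ℝ))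

lemma measure_eq_inv_of_real {A : Set (Space d)} [IsFiniteMeasure μ] {N : ℕ}
    (h : μ.real A = (N : ℝ)⁻¹) (hN : 1 ≤ N) : μ A = (N : ℝ≥0∞)⁻¹ := by
  have hN0 : (0 : ℝ) < N := by exact_mod_cast hN
  rw [← ENNReal.ofReal_toReal (measure_ne_top μ A), ← measureReal_def, h,
    ENNReal.ofReal_inv_of_pos hN0, ENNReal.ofReal_natCast]

/-- On the line, cut at the quantiles. -/
lemma exists_equalPartition_one {μ : Measure (Space 1)} (h : IsTame M μ) {N : ℕ} (hN : 1 ≤ N) :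
    ∃ (c : Fin N → Set (Space 1)) (D : Fin N → ℝ), IsEqualPartition μ c ∧ HasSmallCells c D 2 := by
  have := h.isProbabilityMeasure
  have hN0 : (0 : ℝ) < N := by exact_mod_cast hN
  have hf : Measurable fun x : Space 1 => squash (x 0) := measurable_squash.comp (by fun_prop)
  obtain ⟨q, hq, hq1, hqm⟩ := exists_quantile μ hf (fun x => abs_squash_lt _)
    fun t => h.measure_squash_eq 0 t
  have hmono : Monotone fun k : ℕ => q (k / N) := fun k l hkl => hq (by gcongr)
  refine ⟨fun i => {x | squash (x 0) ∈ Set.Ioc (q (i.1 / N)) (q ((i.1 + 1 : ℕ) / N))},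
    fun i => q ((i.1 + 1 : ℕ) / N) - q (i.1 / N), ⟨fun i => hf measurableSet_Ioc, ?_, ?_⟩,
    ⟨?_, ?_⟩⟩
  · intro i j hij
    exact (hmono.pairwise_disjoint_on_Ioc_succ (Fin.val_ne_of_ne hij)).preimage
      fun x : Space 1 => squash (x 0)
  · intro i
    refine measure_eq_inv_of_real ?_ hN
    rw [hqm]
    · push_cast; field_simp; ring
    · positivity
    · gcongr; simp
    · rw [probReal_univ, div_le_one hN0]; exact_mod_cast i.2
  · intro i x hx y hy
    refine (norm_sub_le_squash x y).trans ?_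
    refine mul_le_mul_of_nonneg_right ?_ (by positivity)
    rw [Fin.sum_univ_one, abs_le]
    have hx1 := hx.1
    have hx2 := hx.2
    have hy1 := hy.1
    have hy2 := hy.2
    constructor <;> linarith
  · rw [Nat.cast_one, div_one, sub_self, Real.rpow_zero, mul_one,
      Fin.sum_univ_eq_sum_range fun k : ℕ => q ((k + 1 : ℕ) / N) - q (k / N)]
    exact sum_quantile_le hq1 (fun k => k / N) N

lemma sum_range_mul_eq (m : ℕ) (F : ℕ → ℕ → ℝ) :
    ∑ i ∈ Finset.range (m * m), F (i / m) (i % m) =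
      ∑ k ∈ Finset.range m, ∑ j ∈ Finset.range m, F k j := by
  rw [← Finset.sum_product', Finset.sum_nbij' (fun i => (i / m, i % m)) (fun p => m * p.1 + p.2)]
  · intro i hi
    have hi' := Finset.mem_range.mp hi
    have hm : 0 < m := Nat.pos_of_ne_zero (by rintro rfl; simp at hi')
    exact Finset.mem_product.mpr ⟨Finset.mem_range.mpr (Nat.div_lt_of_lt_mul hi'),
      Finset.mem_range.mpr (Nat.mod_lt _ hm)⟩
  · intro p hp
    obtain ⟨h1, h2⟩ := Finset.mem_product.mp hp
    rw [Finset.mem_range] at h1 h2 ⊢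
    calc m * p.1 + p.2 < m * p.1 + m := by omega
      _ = m * (p.1 + 1) := by ring
      _ ≤ m * m := Nat.mul_le_mul_left m h1
  · intro i _
    exact Nat.div_add_mod i m
  · intro p hp
    obtain ⟨-, h2⟩ := Finset.mem_product.mp hp
    rw [Finset.mem_range] at h2
    have hm : 0 < m := by omega
    ext
    · simp [Nat.mul_add_div hm, Nat.div_eq_of_lt h2]
    · simp [Nat.mod_eq_of_lt h2]
  · intro i _; rfl

/-- In the plane, cut into about `√N` vertical strips at the quantiles of the first coordinate,
and each of them into about `√N` cells at the quantiles of the second one. -/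
lemma exists_equalPartition_two {μ : Measure (Space 2)} (h : IsTame M μ) {N : ℕ} (hN : 1 ≤ N) :
    ∃ (c : Fin N → Set (Space 2)) (D : Fin N → ℝ), IsEqualPartition μ c ∧ HasSmallCells c D 8 := by
  have := h.isProbabilityMeasure
  have hN0 : (0 : ℝ) < N := by exact_mod_cast hN
  set m := Nat.sqrt N + 1 with hm
  have hm0 : 0 < m := Nat.succ_pos _
  have hmN : N < m * m := Nat.lt_succ_sqrt N
  have hf : ∀ e, Measurable fun x : Space 2 => squash (x e) := fun e =>
    measurable_squash.comp (by fun_prop)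
  obtain ⟨q, hq, hq1, hqm⟩ := exists_quantile μ (hf 0) (fun x => abs_squash_lt _)
    fun t => h.measure_squash_eq 0 t
  -- The last strip may hold fewer than `m` cells, and later ones are empty.
  let s : ℕ → ℝ := fun k => min (k * m : ℕ) N / N
  have hs : Monotone s := fun k l hkl => by
    simp only [s]; gcongr
  have hs0 : ∀ k, 0 ≤ s k := fun k => by positivity
  have hs1 : ∀ k, s k ≤ 1 := fun k => by
    simp only [s]; rw [div_le_one hN0]; exact_mod_cast min_le_right (k * m) N
  let A : ℕ → Set (Space 2) := fun k => {x | squash (x 0) ∈ Set.Ioc (q (s k)) (q (s (k + 1)))}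
  have hA : ∀ k, MeasurableSet (A k) := fun k => hf 0 measurableSet_Ioc
  have hAd : Pairwise (Function.onFun Disjoint A) := fun k l hkl =>
    ((hq.comp hs).pairwise_disjoint_on_Ioc_succ hkl).preimage fun x : Space 2 => squash (x 0)
  have hAm : ∀ k, μ.real (A k) = s (k + 1) - s k := fun k =>
    hqm _ _ (hs0 k) (hs k.le_succ) (by rw [probReal_univ]; exact hs1 _)
  have hquant : ∀ k, ∃ r : ℝ → ℝ, Monotone r ∧ (∀ t, |r t| ≤ 1) ∧
      ∀ a b, 0 ≤ a → a ≤ b → b ≤ (μ.restrict (A k)).real Set.univ →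
        (μ.restrict (A k)).real {x | squash (x 1) ∈ Set.Ioc (r a) (r b)} = b - a := fun k =>
    exists_quantile (μ.restrict (A k)) (hf 1) (fun x => abs_squash_lt _) fun t =>
      Measure.absolutelyContinuous_of_le Measure.restrict_le_self (h.measure_squash_eq 1 t)
  choose r hr hr1 hrm using hquant
  let B : ℕ → ℕ → Set (Space 2) := fun k j =>
    {x | squash (x 1) ∈ Set.Ioc (r k (j / N)) (r k ((j + 1 : ℕ) / N))}
  have hB : ∀ k j, MeasurableSet (B k j) := fun k j => hf 1 measurableSet_Ioc
  have hBd : ∀ k, Pairwise (Function.onFun Disjoint (B k)) := fun k j l hjl => by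
    have hmono : Monotone fun j : ℕ => r k (j / N) := fun a b hab => hr k (by gcongr)
    exact (hmono.pairwise_disjoint_on_Ioc_succ hjl).preimage fun x : Space 2 => squash (x 1)
  let w : ℕ → ℕ → ℝ := fun k j => (q (s (k + 1)) - q (s k)) +
    (r k ((j + 1 : ℕ) / N) - r k (j / N))
  have hw0 : ∀ k j, 0 ≤ w k j := fun k j => by
    have h1 := hq (hs k.le_succ)
    have h2 : r k (j / N) ≤ r k ((j + 1 : ℕ) / N) := hr k (by gcongr; simp)
    simp only [w]
    simp only [Nat.succ_eq_add_one] at h1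
    linarith
  refine ⟨fun i => A (i.1 / m) ∩ B (i.1 / m) (i.1 % m), fun i => w (i.1 / m) (i.1 % m),
    ⟨fun i => (hA _).inter (hB _ _), ?_, ?_⟩, ⟨?_, ?_⟩⟩
  · intro i j hij
    by_cases hk : i.1 / m = j.1 / m
    · have hj : i.1 % m ≠ j.1 % m := fun hmod => hij (Fin.ext (by
        rw [← Nat.div_add_mod i.1 m, ← Nat.div_add_mod j.1 m, hk, hmod]))
      simp only [Function.onFun, hk]
      exact (hBd _ hj).mono Set.inter_subset_right Set.inter_subset_right
    · exact (hAd hk).mono Set.inter_subset_left Set.inter_subset_left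
  · intro i
    refine measure_eq_inv_of_real ?_ hN
    have hdm := Nat.div_add_mod i.1 m
    have hlt := Nat.mod_lt i.1 hm0
    have hiN := i.2
    set k := i.1 / m
    set j := i.1 % m
    have hbound : ((j + 1 : ℕ) : ℝ) / N ≤ (μ.restrict (A k)).real Set.univ := by
      rw [measureReal_restrict_apply_univ, hAm]
      simp only [s]
      rw [← sub_div]
      gcongr
      have h1 : k * m ≤ N := by rw [mul_comm]; omega
      have h2 : m * k = k * m := mul_comm m k
      have h3 : j + 1 + k * m ≤ min ((k + 1) * m) N :=
        le_min (by rw [add_mul]; omega) (by omega)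
      rw [min_eq_left h1, le_sub_iff_add_le]
      exact_mod_cast h3
    have := hrm k (j / N) ((j + 1 : ℕ) / N) (by positivity) (by gcongr; simp) hbound
    rw [measureReal_restrict_apply (hB k j), Set.inter_comm] at this
    rw [this]
    push_cast
    field_simp
    ring
  · intro i x hx y hy
    refine (norm_sub_le_squash x y).trans ?_
    refine mul_le_mul_of_nonneg_right ?_ (by positivity)
    obtain ⟨⟨hx1, hx2⟩, hx3, hx4⟩ := hx
    obtain ⟨⟨hy1, hy2⟩, hy3, hy4⟩ := hy
    rw [Fin.sum_univ_two]
    refine add_le_add ?_ ?_ <;> rw [abs_le] <;> constructor <;> linarith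
  · have hsum : ∑ i : Fin N, w (i.1 / m) (i.1 % m) ≤ 4 * m := by
      rw [Fin.sum_univ_eq_sum_range fun i : ℕ => w (i / m) (i % m)]
      calc ∑ i ∈ Finset.range N, w (i / m) (i % m)
          ≤ ∑ i ∈ Finset.range (m * m), w (i / m) (i % m) :=
            Finset.sum_le_sum_of_subset_of_nonneg (Finset.range_mono hmN.le)
              fun i _ _ => hw0 _ _
        _ = ∑ k ∈ Finset.range m, (m * (q (s (k + 1)) - q (s k)) +
              ∑ j ∈ Finset.range m, (r k ((j + 1 : ℕ) / N) - r k (j / N))) := by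
            rw [sum_range_mul_eq]
            refine Finset.sum_congr rfl fun k _ => ?_
            simp only [w, Finset.sum_add_distrib, Finset.sum_const, Finset.card_range,
              nsmul_eq_mul]
        _ ≤ m * ∑ k ∈ Finset.range m, (q (s (k + 1)) - q (s k)) + m * 2 := by
            rw [Finset.sum_add_distrib, ← Finset.mul_sum]
            gcongr
            refine (Finset.sum_le_sum fun k _ =>
              sum_quantile_le (hr1 k) (fun j : ℕ => (j : ℝ) / N) m).trans_eq ?_
            simp
        _ ≤ m * 2 + m * 2 := by
            gcongr
            exact sum_quantile_le hq1 s m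
        _ = 4 * m := by ring
    have hmr : (m : ℝ) ≤ 2 * Real.sqrt N := by
      have h1 : (Nat.sqrt N : ℝ) ≤ Real.sqrt N := Real.nat_sqrt_le_real_sqrt
      have h2 : 1 ≤ Real.sqrt N := Real.one_le_sqrt.mpr (by exact_mod_cast hN)
      rw [hm]; push_cast; linarith
    have hpow : (N : ℝ) ^ (1 - 1 / ((2 : ℕ) : ℝ)) = Real.sqrt N := by
      rw [Real.sqrt_eq_rpow]; norm_num
    rw [hpow]
    linarith

/-! ### Self-interactions of the cells and conclusion -/

/-- In the logarithmic cases, the self-interaction of a measure carried by a cell of compactified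
diameter `D`, compared with the one at the scale `N^{-1/d}`. -/
lemma neg_interaction_self_le (hd : 1 ≤ d) (h2 : d ≤ 2) (hν : IsTame K ν) {c : Set (Space d)}
    (hc : ∀ᵐ x ∂ν, x ∈ c) {D : ℝ} {N : ℕ} (hN : 1 ≤ N)
    (hD : ∀ x ∈ c, ∀ y ∈ c, ‖x - y‖ ≤ D * ((1 + ‖x‖) * (1 + ‖y‖))) :
    -interaction ν ν ≤ -(Real.log N / d) + (N : ℝ) ^ (1 / (d : ℝ)) * D
      + 2 * ∫ x, logGrowth x ∂ν := by
  have := hν.isProbabilityMeasure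
  have hN0 : (0 : ℝ) < N := by exact_mod_cast hN
  have hl := hν.integrable_logGrowth
  have i1 : Integrable (fun p : Space d × Space d => logGrowth p.1) (ν.prod ν) := hl.comp_fst ν
  have i2 : Integrable (fun p : Space d × Space d => logGrowth p.2) (ν.prod ν) := hl.comp_snd ν
  have i12 : Integrable (fun p : Space d × Space d => logGrowth p.1 + logGrowth p.2) (ν.prod ν) :=
    i1.add i2
  have hR : -(Real.log N / d) + (N : ℝ) ^ (1 / (d : ℝ)) * D + 2 * ∫ x, logGrowth x ∂ν =
      ∫ p, (-(Real.log N / d) + (N : ℝ) ^ (1 / (d : ℝ)) * D +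
        (logGrowth p.1 + logGrowth p.2)) ∂(ν.prod ν) := by
    rw [integral_add (integrable_const _) i12, integral_add i1 i2, integral_fun_fst,
      integral_fun_snd]
    simp
    ring
  rw [hν.interaction_eq hd hν, ← integral_neg, hR]
  refine integral_mono_ae (hν.integrable_g_prod hd hν).neg ((integrable_const _).add i12) ?_
  filter_upwards [hν.ae_prod_ne hd ν, Measure.quasiMeasurePreserving_fst.ae hc,
    Measure.quasiMeasurePreserving_snd.ae hc] with p hp h1 h2'
  have hp0 : 0 < ‖p.1 - p.2‖ := norm_pos_iff.mpr hp
  have hs := hD p.1 h1 p.2 h2'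
  have hA : 0 < 1 + ‖p.1‖ := by positivity
  have hB : 0 < 1 + ‖p.2‖ := by positivity
  have hD0 : 0 < D := by
    by_contra hcon
    have := mul_nonneg (by linarith : 0 ≤ -D) (mul_pos hA hB).le
    linarith
  have hNp : 0 < (N : ℝ) ^ (1 / (d : ℝ)) := by positivity
  simp only [g, if_pos h2, neg_neg, logGrowth]
  have e : Real.log ((N : ℝ) ^ (1 / (d : ℝ)) * D) = Real.log N / d + Real.log D := by
    rw [Real.log_mul hNp.ne' hD0.ne', Real.log_rpow hN0]; ring
  have e1 : Real.log ‖p.1 - p.2‖ ≤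
      Real.log D + (Real.log (1 + ‖p.1‖) + Real.log (1 + ‖p.2‖)) := by
    rw [← Real.log_mul hA.ne' hB.ne', ← Real.log_mul hD0.ne' (mul_pos hA hB).ne']
    exact Real.log_le_log hp0 hs
  have e2 := Real.log_le_self (mul_pos hNp hD0).le
  linarith

lemma IsEqualPartition.neg_sum_interaction_le {N : ℕ} {c : Fin N → Set (Space d)}
    {D : Fin N → ℝ} {C : ℝ} (h : IsEqualPartition μ c) (hD : HasSmallCells c D C) (hd : 1 ≤ d)
    (h2 : d ≤ 2) (hN : 1 ≤ N) (hμ : IsTame M μ) :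
    -∑ i, interaction ((N : ℝ≥0) • μ.restrict (c i)) ((N : ℝ≥0) • μ.restrict (c i)) ≤
      -(N * Real.log N / d) + (C + 2 * ∫ x, logGrowth x ∂μ) * N := by
  have := hμ.isProbabilityMeasure
  have hN0 : (0 : ℝ) < N := by exact_mod_cast hN
  have h1 : ∑ i, -interaction ((N : ℝ≥0) • μ.restrict (c i)) ((N : ℝ≥0) • μ.restrict (c i)) ≤
      ∑ i, (-(Real.log N / d) + (N : ℝ) ^ (1 / (d : ℝ)) * D i
        + 2 * ∫ x, logGrowth x ∂((N : ℝ≥0) • μ.restrict (c i))) := by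
    refine Finset.sum_le_sum fun i _ => ?_
    refine neg_interaction_self_le hd h2 (h.isTame_cell hN hμ i) ?_ hN (hD.norm_sub_le i)
    exact Measure.ae_smul_measure (ae_restrict_mem (h.measurableSet i)) _
  rw [Finset.sum_neg_distrib, Finset.sum_add_distrib, Finset.sum_add_distrib, ← Finset.mul_sum,
    ← Finset.mul_sum, h.sum_integral hN hμ.integrable_logGrowth, Finset.sum_const,
    Finset.card_univ, Fintype.card_fin, nsmul_eq_mul] at h1
  have h3 : (N : ℝ) ^ (1 / (d : ℝ)) * ∑ i, D i ≤ C * N := by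
    refine (mul_le_mul_of_nonneg_left hD.sum_le (by positivity)).trans_eq ?_
    rw [mul_left_comm, ← Real.rpow_add hN0, add_sub_cancel, Real.rpow_one]
  refine h1.trans ?_
  rw [add_mul]
  have e : (N : ℝ) * -(Real.log N / d) = -(N * Real.log N / d) := by ring
  linarith

lemma exists_equalPartition (hd : 1 ≤ d) (h2 : d ≤ 2) (hμ : IsTame M μ) {N : ℕ} (hN : 1 ≤ N) :
    ∃ (c : Fin N → Set (Space d)) (D : Fin N → ℝ),
      IsEqualPartition μ c ∧ HasSmallCells c D 8 := by
  have h12 : d = 1 ∨ d = 2 := by omega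
  rcases h12 with rfl | rfl
  · obtain ⟨c, D, hc, hD⟩ := exists_equalPartition_one hμ hN
    refine ⟨c, D, hc, hD.norm_sub_le, hD.sum_le.trans ?_⟩
    gcongr
    norm_num
  · exact exists_equalPartition_two hμ hN

/-- Lower bound on the partition function. -/
lemma IsTame.exists_le_partitionFunction (hd : 1 ≤ d) (hβ : 0 < β) (h : IsTame M μ)
    (hM : 0 < M) : ∃ C : ℝ, ∀ V : Space d → ℝ, Integrable V μ → ∀ N : ℕ, 1 ≤ N →
      Integrable (fun X : Fin N → Space d => gibbsWeight V β X) →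
        Real.exp (leadingTerm V μ β N - C * N) ≤ partitionFunction V β N := by
  by_cases h2 : d ≤ 2
  · refine ⟨β / 2 * (8 + 2 * ∫ x, logGrowth x ∂μ) + 1 + Real.log M, fun V hV N hN hZ => ?_⟩
    obtain ⟨c, D, hc, hD⟩ := exists_equalPartition hd h2 h hN
    refine (Real.exp_le_exp.mpr ?_).trans (hc.exp_le_partitionFunction hd hN h hM hV hZ)
    have h1 := hc.neg_sum_interaction_le hD hd h2 hN h
    have hp := tempExponent_of_le_two hd h2
    have hl : leadingTerm V μ β N =
        -(β / 2) * ((N : ℝ) ^ 2 * energy V μ) + β / 2 * (N * Real.log N / d) := by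
      rw [leadingTerm, if_pos h2, ← rpow_tempExponent_mul_sq hN, hp, Real.rpow_zero, one_mul]
      have : (0 : ℝ) < d := by exact_mod_cast hd
      field_simp
    rw [hl, hp, Real.rpow_zero, mul_one]
    have h3 := mul_le_mul_of_nonneg_left h1 (by positivity : 0 ≤ β / 2)
    linarith
  · exact ⟨Real.log M, fun V hV N hN hZ =>
      h.exp_le_partitionFunction_of_three_le h2 hβ hM hV hN hZ⟩

lemma HasBoundedDensity.exists_le_smul (h : HasBoundedDensity μ) :
    ∃ M : ℝ≥0, 0 < M ∧ μ ≤ M • (volume : Measure (Space d)) := by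
  obtain ⟨ρ, hρ, rfl⟩ := h
  refine ⟨(eLpNormEssSup ρ volume).toNNReal + 1, by positivity, ?_⟩
  have hfin : eLpNormEssSup ρ volume ≠ ⊤ := by
    have := hρ.2
    rw [eLpNorm_exponent_top] at this
    exact this.ne
  have e : ((eLpNormEssSup ρ volume).toNNReal + 1) • (volume : Measure (Space d)) =
      volume.withDensity fun _ => (((eLpNormEssSup ρ volume).toNNReal + 1 : ℝ≥0) : ℝ≥0∞) := by
    rw [withDensity_const]; rfl
  rw [e]
  refine withDensity_mono ?_
  filter_upwards [enorm_ae_le_eLpNormEssSup ρ volume] with x hx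
  calc ENNReal.ofReal (ρ x) ≤ ‖ρ x‖ₑ := by
        rw [← ofReal_norm]
        exact ENNReal.ofReal_le_ofReal (le_abs_self _)
    _ ≤ eLpNormEssSup ρ volume := hx
    _ = ((eLpNormEssSup ρ volume).toNNReal : ℝ≥0∞) := (ENNReal.coe_toNNReal hfin).symm
    _ ≤ _ := by push_cast; exact le_self_add

/-- An equilibrium measure of an admissible potential lives on a set of finite Lebesgue measure. -/
lemma IsTame.exists_finite_support (hd : 1 ≤ d) (hβ : 0 < β) (h : IsTame M μ)
    (hc : Continuous V) (hV : IsEquilibriumMeasure V μ) (hA : AssumptionA3 V β) :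
    ∃ S : Set (Space d), MeasurableSet S ∧ volume S ≠ ⊤ ∧ μ Sᶜ = 0 := by
  have := h.isProbabilityMeasure
  obtain ⟨θ, -, hint⟩ := h.exists_integrable_exp_effectivePotential hd hc hV hβ hA
  refine ⟨{x | effectivePotential V μ x = 0},
    measurable_effectivePotential hc μ (measurableSet_singleton 0), ?_,
    ae_iff.mp (h.effectivePotential_ae_eq_zero hd hc hV)⟩
  refine ((measure_mono fun x hx => ?_).trans_lt (hint.measure_norm_ge_lt_top one_pos)).ne
  have hx' : effectivePotential V μ x = 0 := hx
  simp [hx']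

end CoulombGas

end

theorem proposition3p9 (d : ℕ) (hd : 1 ≤ d) (β : ℝ) (hβ : 0 < β)
    (μ : Measure (EuclideanSpace ℝ (Fin d))) (hμ : CoulombGas.HasBoundedDensity μ) :
    ∃ C : ℝ, ∀ V : EuclideanSpace ℝ (Fin d) → ℝ, Continuous V →
      CoulombGas.IsEquilibriumMeasure V μ → CoulombGas.AssumptionA3 V β →
      ∀ᶠ N : ℕ in atTop,
        Integrable (fun X : Fin N → EuclideanSpace ℝ (Fin d) => CoulombGas.gibbsWeight V β X)
          volume ∧
        |Real.log (CoulombGas.partitionFunction V β N)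
            - (-(β / 2) * (N : ℝ) ^ min 2 (2 / (d : ℝ) + 1) * CoulombGas.energy V μ
              + (if d ≤ 2 then β / (2 * (d : ℝ)) * N * Real.log N else 0))| ≤ C * N := by
  -- The constants are chosen before `V`. The properties of `μ` they rest on do not involve `V`,
  -- but are known only because `μ` is the equilibrium measure of some potential.
  by_cases hex : ∃ V : EuclideanSpace ℝ (Fin d) → ℝ, Continuous V ∧
      CoulombGas.IsEquilibriumMeasure V μ ∧ CoulombGas.AssumptionA3 V β
  · obtain ⟨V₀, hc₀, hV₀, hA₀⟩ := hex
    obtain ⟨M, hM, hle⟩ := hμ.exists_le_smul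
    have := hV₀.isProbabilityMeasure
    have ht : CoulombGas.IsTame M μ :=
      CoulombGas.IsTame.of_integrable_g hle hV₀.hasFiniteEnergy.integrable_interaction
    obtain ⟨S, hS, hSfin, hμS⟩ := ht.exists_finite_support hd hβ hc₀ hV₀ hA₀
    obtain ⟨C₁, hC₁⟩ := ht.exists_partitionFunction_le hd hβ hS hSfin hμS
    obtain ⟨C₂, hC₂⟩ := ht.exists_le_partitionFunction hd hβ hM
    refine ⟨max C₁ C₂, fun V hc hV hA => ?_⟩
    filter_upwards [hC₁ V hc hV hA, eventually_ge_atTop 1] with N hN hN1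
    refine ⟨hN.1, ?_⟩
    have hlow := hC₂ V hV.hasFiniteEnergy.integrable_potential N hN1 hN.1
    have hpos : 0 < CoulombGas.partitionFunction V β N := (Real.exp_pos _).trans_le hlow
    have h1 := (Real.log_le_iff_le_exp hpos).mpr hN.2
    have h2 := (Real.le_log_iff_exp_le hpos).mpr hlow
    have h3 : C₁ * N ≤ max C₁ C₂ * N := by gcongr; exact le_max_left _ _
    have h4 : C₂ * N ≤ max C₁ C₂ * N := by gcongr; exact le_max_right _ _
    change |Real.log (CoulombGas.partitionFunction V β N) - CoulombGas.leadingTerm V μ β N| ≤ _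
    rw [abs_le]
    constructor <;> linarith
  · exact ⟨0, fun V hc hV hA => absurd ⟨V, hc, hV, hA⟩ hex⟩
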